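/- Let $\Omega=(-1.2,1.2)^3$, let $D\subset[-1,1]^3$ be a nonempty Lipschitz set (near every boundary point $D$ is, in suitable orthonormal coordinates, the region below the graph of a Lipschitz function), and let $\mathcal S=\partial D$, with two-dimensional surface (Hausdorff) measure $\mathrm da$. Let $H^1(\Omega)$ be the space of $L^2(\Omega)$ functions with weak gradient in $L^2(\Omega;\mathbb R^3)$. Then $0<\int_{\mathcal S}\mathrm da<\infty$, and there is exactly one bounded linear trace operator $H^1(\Omega)\to L^2(\mathcal S)$ that agrees with the pointwise restriction to $\mathcal S$ for every $u\in H^1(\Omega)$ that is continuous in a neighbourhood of $\mathcal S$; so the mean $$M_{\mathcal S}(u):=\Big(\int_{\mathcal S}\mathrm da\Big)^{-1}\int_{\mathcal S}u\,\mathrm da ,$$ in which $u$ stands for its trace on $\mathcal S$, is well defined for every $u\in H^1(\Omega)$. For every time step $\tau>0$ the energy $$\mathcal E(u)=\int_\Omega u^2\,\mathrm dx-2\,M_{\mathcal S}(u)+\tau\int_\Omega|\nabla u|^2\,\mathrm dx$$ has a unique minimizer $u^\tau$ in $H^1(\Omega)$. It solves $0=\partial_u\mathcal E(u^\tau)$,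 that is, for every $\vartheta\in H^1(\Omega)$ one has $\frac{\mathrm d}{\mathrm ds}\big|_{s=0}\mathcal E(u^\tau+s\vartheta)=0$ and $$0=\int_\Omega u^\tau\vartheta\,\mathrm dx-M_{\mathcal S}(\vartheta)+\tau\int_\Omega\nabla u^\tau\cdot\nabla\vartheta\,\mathrm dx ,$$ the weak form of the backward Euler step of the heat equation with the mean surface measure of $\mathcal S$ as initial data. -/

import Mathlib

open MeasureTheory
open scoped NNReal ENNReal ContDiff

noncomputable section

namespace HeatStep

/-- Euclidean three-space. -/
abbrev E3 : Type := EuclideanSpace ℝ (Fin 3)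

/-- The Euclidean plane. -/
abbrev E2 : Type := EuclideanSpace ℝ (Fin 2)

/-- The computational domain `(-1.2, 1.2)³`. -/
def Omega : Set E3 := {x | ∀ i, x i ∈ Set.Ioo (-(6 / 5 : ℝ)) (6 / 5)}

/-- The closed cube `[-1, 1]³`. -/
def unitCube : Set E3 := {x | ∀ i, x i ∈ Set.Icc (-1 : ℝ) 1}

/-- Lebesgue measure on `Ω`. -/
abbrev volOmega : Measure E3 := volume.restrict Omega

/-- `D` is a Lipschitz set: near each of its boundary points, in suitable orthonormal coordinates
`(y, t) ∈ ℝ² × ℝ`, the set `D` is the region below the graph of a Lipschitz function `γ : ℝ² → ℝ`.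
It is left free which points of the graph itself belong to `D`, so that open and closed sets are
both covered; only the boundary of `D` will matter. -/
def IsLipschitzSet (D : Set E3) : Prop :=
  ∀ p ∈ frontier D, ∃ (U : Set E3) (e : E3 ≃ₗᵢ[ℝ] WithLp 2 (E2 × ℝ)) (K : ℝ≥0) (γ : E2 → ℝ),
    IsOpen U ∧ p ∈ U ∧ LipschitzWith K γ ∧
      ∀ x ∈ U, ((e x).snd < γ (e x).fst → x ∈ D) ∧ (γ (e x).fst < (e x).snd → x ∉ D)

/-- The two-dimensional surface measure on `S`. -/
abbrev surfaceMeasure (S : Set E3) : Measure E3 :=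
  (Measure.euclideanHausdorffMeasure 2 : Measure E3).restrict S

/-- `G` is the weak gradient of `u` on `Ω`. -/
def IsWeakGradient (u : E3 → ℝ) (G : E3 → E3) : Prop :=
  ∀ φ : E3 → ℝ, ContDiff ℝ ∞ φ → HasCompactSupport φ → tsupport φ ⊆ Omega →
    ∀ i : Fin 3,
      ∫ x in Omega, u x * fderiv ℝ φ x (EuclideanSpace.single i 1) = -∫ x in Omega, G x i * φ x

theorem memLp_test {φ : E3 → ℝ} (h : Continuous φ) (hc : HasCompactSupport φ) :
    MemLp φ 2 volOmega :=
  (h.memLp_of_hasCompactSupport hc).restrict _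

theorem memLp_test_fderiv {φ : E3 → ℝ} (h : ContDiff ℝ ∞ φ) (hc : HasCompactSupport φ)
    (v : E3) : MemLp (fun x => fderiv ℝ φ x v) 2 volOmega := by
  refine memLp_test ?_ ?_
  · exact (h.continuous_fderiv (by simp)).clm_apply continuous_const
  · exact hc.fderiv_apply ℝ v

theorem memLp_coord (G : Lp E3 2 volOmega) (i : Fin 3) : MemLp (fun x => G x i) 2 volOmega :=
  (EuclideanSpace.proj i : E3 →L[ℝ] ℝ).comp_memLp' (Lp.memLp G)

/-- The Sobolev space `H¹(Ω)`: the functions `u ∈ L²(Ω)` that have a weak gradient in `L²(Ω; ℝ³)`.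
An element is stored as the pair `(u, ∇u)`, where the second entry is determined by the first, and
the norm is `(‖u‖² + ‖∇u‖²)^{1/2}` with the `L²` norms on the right. -/
def H1 : Submodule ℝ (WithLp 2 (Lp ℝ 2 volOmega × Lp E3 2 volOmega)) where
  carrier := {p | IsWeakGradient p.fst p.snd}
  zero_mem' := by
    intro φ _ _ _ i
    have h1 : ∫ x in Omega, (0 : Lp ℝ 2 volOmega) x * fderiv ℝ φ x (EuclideanSpace.single i 1)
        = 0 := by
      refine integral_eq_zero_of_ae ?_
      filter_upwards [Lp.coeFn_zero ℝ 2 volOmega] with x hx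
      rw [hx]
      simp
    have h2 : ∫ x in Omega, (0 : Lp E3 2 volOmega) x i * φ x = 0 := by
      refine integral_eq_zero_of_ae ?_
      filter_upwards [Lp.coeFn_zero E3 2 volOmega] with x hx
      rw [hx]
      simp
    rw [WithLp.zero_fst, WithLp.zero_snd, h1, h2, neg_zero]
  add_mem' := by
    intro p q hp hq φ h1 h2 h3 i
    have hd := memLp_test_fderiv h1 h2 (EuclideanSpace.single i 1)
    have hφ := memLp_test h1.continuous h2
    have e1 : ∫ x in Omega, (p.fst + q.fst) x * fderiv ℝ φ x (EuclideanSpace.single i 1)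
        = (∫ x in Omega, p.fst x * fderiv ℝ φ x (EuclideanSpace.single i 1))
          + ∫ x in Omega, q.fst x * fderiv ℝ φ x (EuclideanSpace.single i 1) := by
      refine Eq.trans (integral_congr_ae ?_) (integral_add ((Lp.memLp p.fst).integrable_mul hd)
        ((Lp.memLp q.fst).integrable_mul hd))
      filter_upwards [Lp.coeFn_add p.fst q.fst] with x hx
      rw [hx]
      simp [add_mul]
    have e2 : ∫ x in Omega, (p.snd + q.snd) x i * φ x
        = (∫ x in Omega, p.snd x i * φ x) + ∫ x in Omega, q.snd x i * φ x := by
      refine Eq.trans (integral_congr_ae ?_) (integral_add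
        ((memLp_coord p.snd i).integrable_mul hφ) ((memLp_coord q.snd i).integrable_mul hφ))
      filter_upwards [Lp.coeFn_add p.snd q.snd] with x hx
      rw [hx]
      simp [add_mul]
    rw [WithLp.add_fst, WithLp.add_snd, e1, e2, hp φ h1 h2 h3 i, hq φ h1 h2 h3 i]
    ring
  smul_mem' := by
    intro c p hp φ h1 h2 h3 i
    have e1 : ∫ x in Omega, (c • p.fst) x * fderiv ℝ φ x (EuclideanSpace.single i 1)
        = c * ∫ x in Omega, p.fst x * fderiv ℝ φ x (EuclideanSpace.single i 1) := by
      rw [← integral_const_mul]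
      refine integral_congr_ae ?_
      filter_upwards [Lp.coeFn_smul c p.fst] with x hx
      simp [hx, mul_assoc]
    have e2 : ∫ x in Omega, (c • p.snd) x i * φ x = c * ∫ x in Omega, p.snd x i * φ x := by
      rw [← integral_const_mul]
      refine integral_congr_ae ?_
      filter_upwards [Lp.coeFn_smul c p.snd] with x hx
      simp [hx, mul_assoc]
    rw [WithLp.smul_fst, WithLp.smul_snd, e1, e2, hp φ h1 h2 h3 i]
    ring

/-- The function underlying an element of `H¹(Ω)`. -/
def H1.val (u : H1) : Lp ℝ 2 volOmega := (u : WithLp 2 (Lp ℝ 2 volOmega × Lp E3 2 volOmega)).fst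

/-- The weak gradient of an element of `H¹(Ω)`. -/
def H1.grad (u : H1) : Lp E3 2 volOmega := (u : WithLp 2 (Lp ℝ 2 volOmega × Lp E3 2 volOmega)).snd

/-- `T` is the trace operator from `H¹(Ω)` to `L²(S)`: it is linear and bounded, and it is the
pointwise restriction to `S` on every function of `H¹(Ω)` that is continuous near `S`. -/
def IsTraceOperator (S : Set E3) (T : H1 →L[ℝ] Lp ℝ 2 (surfaceMeasure S)) : Prop :=
  ∀ (u : H1) (f : E3 → ℝ) (V : Set E3), IsOpen V → S ⊆ V → ContinuousOn f V →
    H1.val u =ᵐ[volOmega] f → T u =ᵐ[surfaceMeasure S] f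

/-- The mean over `S` of a function in `L²(S)`. -/
def surfaceMean (S : Set E3) (g : Lp ℝ 2 (surfaceMeasure S)) : ℝ :=
  (∫ _x, (1 : ℝ) ∂(surfaceMeasure S))⁻¹ * ∫ x, g x ∂(surfaceMeasure S)

/-- The modified minimizing-movement energy
`∫_Ω u² dx - 2 ⨍_S u da + τ ∫_Ω |∇u|² dx`, where `u` on `S` is understood as the trace `T u`. -/
def energy (S : Set E3) (T : H1 →L[ℝ] Lp ℝ 2 (surfaceMeasure S)) (τ : ℝ) (u : H1) : ℝ :=
  (∫ x in Omega, (H1.val u x) ^ 2) - 2 * surfaceMean S (T u)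
    + τ * ∫ x in Omega, ‖H1.grad u x‖ ^ 2

/-- The weak Euler-Lagrange equation
`0 = ∫_Ω u ϑ dx - ⨍_S ϑ da + τ ∫_Ω ∇u · ∇ϑ dx` for all `ϑ ∈ H¹(Ω)`. -/
def SolvesEulerLagrange (S : Set E3) (T : H1 →L[ℝ] Lp ℝ 2 (surfaceMeasure S)) (τ : ℝ)
    (u : H1) : Prop :=
  ∀ θ : H1, 0 = (∫ x in Omega, H1.val u x * H1.val θ x) - surfaceMean S (T θ)
    + τ * ∫ x in Omega, inner ℝ (H1.grad u x) (H1.grad θ x)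

end HeatStep

end

/-! Once the trace operator exists and is bounded, the energy is `B(u,u) - 2 l(u)` with `B`
symmetric, bounded and coercive on the Hilbert space `H1` and `l` a bounded functional. Lax-Milgram
gives `u` with `B(u,·) = l`, and completing the square (`IsCoercive.exists_unique_minimizer`) shows
that it is the only minimizer.

The substance is the trace. Near a boundary point, `frontier D` is a Lipschitz graph. The squared
value of a `C¹` function at a graph point is bounded by an integral of the function and its
derivative along a short segment transversal to the graph. Integrating over the graph and using
compactness of the boundary gives a trace inequality (`IsLipschitzSet.exists_eLpNorm_frontier_le`)
whose right side only involves a neighbourhood of the boundary inside `midCube`.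

For `u` in `H1` the zero extension is mollified. On `midCube` the gradient of the mollification is
the mollified weak gradient (`gradient_mollify`), so the trace inequality makes the restrictions to
the boundary a Cauchy sequence in `L²`; their limit is the trace. It is the pointwise restriction
where `u` is continuous, because mollifications converge there. Uniqueness follows since functions
continuous near `unitCube` are dense in `H1` (`exists_tendsto_continuousOn`).

The area is finite by the trace inequality for the constant `1`, and positive because the boundary
projects onto a set that contains a nonempty open subset of a plane. -/

noncomputable section

namespace HeatStep

open Filter Topology Convolution

/-! ### Convergence of mollifications in `L²`. -/

section Mollification

variable {E F : Type*} [NormedAddCommGroup E] [InnerProductSpace ℝ E] [FiniteDimensional ℝ E]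
  [MeasurableSpace E] [BorelSpace E] [NormedAddCommGroup F]

/-- Translation is continuous in `L²`. -/
theorem tendsto_eLpNorm_translate_sub {f : E → F} (hf : MemLp f 2 volume) :
    Tendsto (fun t : E => eLpNorm (fun x => f (x - t) - f x) 2 volume) (𝓝 0) (𝓝 0) := by
  -- Translations form a continuous family of measure-preserving maps, and composition with such a
  -- family is continuous in `Lp` for finite exponent.
  let g : C(E, C(E, E)) := ContinuousMap.curry ⟨fun p : E × E => p.2 - p.1, by fun_prop⟩
  have hg : ∀ t, MeasurePreserving (g t) (volume : Measure E) volume := fun t =>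
    measurePreserving_sub_right volume t
  have hc : Continuous fun t => Lp.compMeasurePreserving (g t) (hg t) (hf.toLp f) :=
    continuous_const.compMeasurePreservingLp g.continuous hg (by simp)
  have h := (hc.tendsto 0).edist (tendsto_const_nhds (x := hf.toLp f))
  have h0 : Lp.compMeasurePreserving (g 0) (hg 0) (hf.toLp f) = hf.toLp f := by
    rw [Lp.toLp_compMeasurePreserving]
    congr 1
    ext x
    simp [g]
  rw [h0, edist_self] at h
  refine h.congr fun t => ?_
  rw [Lp.toLp_compMeasurePreserving, Lp.edist_toLp_toLp]
  rfl

/-- The squared `L²` norm as a lower integral. -/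
theorem eLpNorm_two_sq {α G : Type*} [MeasurableSpace α] {μ : Measure α} [NormedAddCommGroup G]
    (f : α → G) : eLpNorm f 2 μ ^ 2 = ∫⁻ x, ‖f x‖ₑ ^ 2 ∂μ := by
  rw [eLpNorm_eq_lintegral_rpow_enorm_toReal (by simp) (by simp), ← ENNReal.rpow_natCast,
    ← ENNReal.rpow_mul]
  simp

/-- Cauchy-Schwarz for a probability measure. -/
theorem lintegral_sq_le {α : Type*} [MeasurableSpace α] {ν : Measure α} [IsProbabilityMeasure ν]
    {g : α → ℝ≥0∞} (hg : AEMeasurable g ν) : (∫⁻ x, g x ∂ν) ^ 2 ≤ ∫⁻ x, g x ^ 2 ∂ν := by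
  have h := ENNReal.lintegral_mul_le_Lp_mul_Lq ν (p := 2) (q := 2) (by constructor <;> norm_num)
    hg (aemeasurable_const (b := 1))
  simp only [Pi.mul_apply, mul_one, ENNReal.one_rpow, lintegral_const, measure_univ] at h
  calc (∫⁻ x, g x ∂ν) ^ 2 ≤ ((∫⁻ x, g x ^ (2 : ℝ) ∂ν) ^ (1 / 2 : ℝ)) ^ 2 := by gcongr
    _ = _ := by
      rw [← ENNReal.rpow_natCast, ← ENNReal.rpow_mul]
      simp

variable [NormedSpace ℝ F] [CompleteSpace F]

/-- The kernel has integral one, so the error at `x` is the mean of `f (x - t) - f x` over a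
probability measure in `t`. Cauchy-Schwarz and Tonelli bound its squared norm by the mean of the
squared translation errors, and only shifts in the support of the kernel count. -/
theorem eLpNorm_convolution_sub_le (φ : ContDiffBump (0 : E)) {f : E → F}
    (hf : MemLp f 2 volume) {c : ℝ≥0∞}
    (hc : ∀ t ∈ Metric.ball (0 : E) φ.rOut, eLpNorm (fun x => f (x - t) - f x) 2 volume ≤ c) :
    eLpNorm (φ.normed volume ⋆[ContinuousLinearMap.lsmul ℝ ℝ, volume] f - f) 2 volume ≤ c := by
  -- Tonelli needs joint measurability in `(x, t)`, hence a strongly measurable representative;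
  -- neither the convolution nor the norms see the change.
  wlog hm : StronglyMeasurable f generalizing f
  · obtain ⟨g, hg, hfg⟩ := hf.1
    have ht : ∀ t : E, (fun x => f (x - t)) =ᵐ[volume] fun x => g (x - t) := fun t =>
      (measurePreserving_sub_right volume t).quasiMeasurePreserving.ae_eq_comp hfg
    have h := this (hf.ae_eq hfg) (fun t h => by
      refine (eLpNorm_congr_ae ?_).trans_le (hc t h)
      filter_upwards [ht t, hfg] with x h1 h2
      rw [h1, h2]) hg
    refine (eLpNorm_congr_ae ?_).trans_le h
    rw [convolution_congr (ContinuousLinearMap.lsmul ℝ ℝ) (EventuallyEq.refl _ _) hfg]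
    filter_upwards [hfg] with x h2
    simp [h2]
  set ρ : E → ℝ≥0∞ := fun t => ENNReal.ofReal (φ.normed volume t) with hρ
  have hρm : Measurable ρ := by
    exact (φ.continuous_normed (μ := volume)).measurable.ennreal_ofReal
  set ν : Measure E := volume.withDensity ρ with hν
  have hprob : IsProbabilityMeasure ν := by
    constructor
    rw [hν, withDensity_apply _ MeasurableSet.univ, Measure.restrict_univ, hρ,
      ← ofReal_integral_eq_lintegral_ofReal φ.integrable_normed
        (Eventually.of_forall φ.nonneg_normed), φ.integral_normed, ENNReal.ofReal_one]
  have hloc : LocallyIntegrable f volume := hf.locallyIntegrable (by norm_num)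
  have hpt : ∀ x, ‖(φ.normed volume ⋆[ContinuousLinearMap.lsmul ℝ ℝ, volume] f - f) x‖ₑ
      ≤ ∫⁻ t, ‖f (x - t) - f x‖ₑ ∂ν := by
    intro x
    have hi : Integrable (fun t => φ.normed volume t • f (x - t)) volume :=
      (φ.hasCompactSupport_normed (μ := volume)).convolutionExists_left
      (ContinuousLinearMap.lsmul ℝ ℝ) φ.continuous_normed hloc x
    have hi2 : Integrable (fun t => φ.normed volume t • f x) volume :=
      φ.integrable_normed.smul_const _
    have e : (φ.normed volume ⋆[ContinuousLinearMap.lsmul ℝ ℝ, volume] f - f) x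
        = ∫ t, φ.normed volume t • (f (x - t) - f x) := by
      simp_rw [smul_sub]
      rw [integral_sub hi hi2, φ.integral_normed_smul]
      rfl
    rw [e, hν, lintegral_withDensity_eq_lintegral_mul_non_measurable _ hρm (by simp [hρ])]
    refine (enorm_integral_le_lintegral_enorm _).trans (lintegral_mono fun t => ?_)
    rw [enorm_smul, Real.enorm_of_nonneg (φ.nonneg_normed t)]
    rfl
  have hmeas : StronglyMeasurable fun p : E × E => f (p.1 - p.2) - f p.1 :=
    (hm.comp_measurable (measurable_fst.sub measurable_snd)).sub (hm.comp_measurable measurable_fst)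
  refine (ENNReal.pow_le_pow_left_iff two_ne_zero).1 ?_
  calc eLpNorm (φ.normed volume ⋆[ContinuousLinearMap.lsmul ℝ ℝ, volume] f - f) 2 volume ^ 2
      ≤ ∫⁻ x, (∫⁻ t, ‖f (x - t) - f x‖ₑ ^ 2 ∂ν) := by
        rw [eLpNorm_two_sq]
        refine lintegral_mono fun x => (pow_le_pow_left₀ zero_le (hpt x) 2).trans
          (lintegral_sq_le ?_)
        exact (hmeas.comp_measurable measurable_prodMk_left).enorm.aemeasurable
    _ = ∫⁻ t, (∫⁻ x, ‖f (x - t) - f x‖ₑ ^ 2) ∂ν := by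
        refine lintegral_lintegral_swap ?_
        exact (hmeas.enorm.pow_const 2).aemeasurable
    _ = ∫⁻ t, ρ t * eLpNorm (fun x => f (x - t) - f x) 2 volume ^ 2 := by
        simp_rw [eLpNorm_two_sq]
        rw [hν, lintegral_withDensity_eq_lintegral_mul_non_measurable _ hρm (by simp [hρ])]
        rfl
    _ ≤ ∫⁻ t, ρ t * c ^ 2 := by
        refine lintegral_mono fun t => ?_
        by_cases ht : t ∈ Metric.ball (0 : E) φ.rOut
        · exact mul_le_mul_right (pow_le_pow_left₀ zero_le (hc t ht) 2) _
        · rw [← φ.support_normed_eq (μ := volume), Function.notMem_support] at ht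
          simp [hρ, ht]
    _ = c ^ 2 := by
        rw [lintegral_mul_const _ hρm]
        have := hprob.measure_univ
        rw [hν, withDensity_apply _ MeasurableSet.univ, Measure.restrict_univ] at this
        rw [this, one_mul]

/-- Mollifications converge in `L²`. -/
theorem tendsto_eLpNorm_convolution_sub {φ : ℕ → ContDiffBump (0 : E)}
    (hφ : Tendsto (fun n => (φ n).rOut) atTop (𝓝 0)) {f : E → F} (hf : MemLp f 2 volume) :
    Tendsto (fun n => eLpNorm
      ((φ n).normed volume ⋆[ContinuousLinearMap.lsmul ℝ ℝ, volume] f - f) 2 volume)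
      atTop (𝓝 0) := by
  refine ENNReal.tendsto_atTop_zero.2 fun c hc => ?_
  obtain ⟨r, hr, h⟩ := Metric.eventually_nhds_iff_ball.1
    ((tendsto_eLpNorm_translate_sub hf).eventually_le_const hc)
  obtain ⟨N, hN⟩ := eventually_atTop.1 (hφ.eventually_lt_const hr)
  exact ⟨N, fun n hn => eLpNorm_convolution_sub_le _ hf fun t ht =>
    h t (Metric.ball_subset_ball (hN n hn).le ht)⟩

end Mollification

/-! ### Hausdorff measure under Lipschitz maps. -/

section Hausdorff

variable {X Y : Type*} [EMetricSpace X] [MeasurableSpace X] [BorelSpace X]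
  [EMetricSpace Y] [MeasurableSpace Y] [BorelSpace Y]

theorem _root_.LipschitzWith.euclideanHausdorffMeasure_image_le {K : ℝ≥0} {f : X → Y}
    (hf : LipschitzWith K f) (d : ℕ) (s : Set X) :
    μHE[d] (f '' s) ≤ (K : ℝ≥0∞) ^ d * μHE[d] s := by
  rw [Measure.euclideanHausdorffMeasure_def, Measure.euclideanHausdorffMeasure_def,
    Measure.smul_apply, Measure.smul_apply, ENNReal.smul_def, ENNReal.smul_def, smul_eq_mul,
    smul_eq_mul, mul_left_comm]
  refine mul_le_mul_right ?_ _
  simpa using hf.hausdorffMeasure_image_le (d := (d : ℝ)) (Nat.cast_nonneg d) s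

/-- On the range of a Lipschitz map the Hausdorff measure is controlled by the pushforward. -/
theorem _root_.LipschitzWith.setLIntegral_range_le {K : ℝ≥0} {f : X → Y}
    (hf : LipschitzWith K f) (d : ℕ) (s : Set Y) {g : Y → ℝ≥0∞} (hg : Measurable g) :
    ∫⁻ y in s ∩ Set.range f, g y ∂(μHE[d] : Measure Y)
      ≤ (K : ℝ≥0∞) ^ d * ∫⁻ x in f ⁻¹' s, g (f x) ∂(μHE[d] : Measure X) := by
  have hfm : Measurable f := hf.continuous.measurable
  have hle : (μHE[d] : Measure Y).restrict (s ∩ Set.range f)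
      ≤ (K : ℝ≥0∞) ^ d • ((μHE[d] : Measure X).restrict (f ⁻¹' s)).map f := by
    refine Measure.le_iff.2 fun t ht => ?_
    rw [Measure.restrict_apply ht, Measure.smul_apply, smul_eq_mul, Measure.map_apply hfm ht,
      Measure.restrict_apply (hfm ht)]
    refine le_trans (measure_mono ?_) (hf.euclideanHausdorffMeasure_image_le d _)
    rintro y ⟨hy, hys, x, rfl⟩
    exact ⟨x, ⟨hy, hys⟩, rfl⟩
  refine (lintegral_mono' hle le_rfl).trans_eq ?_
  rw [lintegral_smul_measure, smul_eq_mul, lintegral_map hg hfm]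

end Hausdorff

/-! ### The trace estimate over one Lipschitz graph. -/

/-- The value of a `C¹` function at an endpoint is controlled by its `H¹` norm. -/
theorem ofReal_sq_le_lintegral {w : ℝ → ℝ} (hw : ContDiff ℝ 1 w) {δ : ℝ} (hδ : 0 < δ) :
    ENNReal.ofReal (w 0 ^ 2) ≤ ENNReal.ofReal (δ⁻¹ + 1) *
      ∫⁻ t in Set.Ioc 0 δ, ENNReal.ofReal (w t ^ 2 + deriv w t ^ 2) := by
  have hd : Continuous (deriv w) := hw.continuous_deriv le_rfl
  have hc : Continuous w := hw.continuous
  -- The weight `1 - t/δ` is `1` at `0` and `0` at `δ`, so the fundamental theorem of calculus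
  -- yields `w 0 ^ 2` with no term at `δ`. The constant `δ⁻¹ + 1` then comes from `2|w w'| ≤ w² +
  -- w'²`.
  have hder : ∀ t, HasDerivAt (fun t => -((1 - δ⁻¹ * t) * w t ^ 2))
      (δ⁻¹ * w t ^ 2 - (1 - δ⁻¹ * t) * (2 * w t * deriv w t)) t := by
    intro t
    have h1 : HasDerivAt w (deriv w t) t :=
      (hw.differentiable one_ne_zero t).hasDerivAt
    have h2 := ((((hasDerivAt_id t).const_mul δ⁻¹).const_sub 1).mul (h1.pow 2)).neg
    convert! h2 using 1
    simp
    ring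
  have hftc := intervalIntegral.integral_eq_sub_of_hasDerivAt (a := 0) (b := δ)
    (fun t _ => hder t) (by
      apply Continuous.intervalIntegrable
      fun_prop)
  have h0 : w 0 ^ 2 = ∫ t in (0 : ℝ)..δ,
      (δ⁻¹ * w t ^ 2 - (1 - δ⁻¹ * t) * (2 * w t * deriv w t)) := by
    rw [hftc]
    simp [hδ.ne']
  have hle : w 0 ^ 2 ≤ ∫ t in (0 : ℝ)..δ, (δ⁻¹ + 1) * (w t ^ 2 + deriv w t ^ 2) := by
    rw [h0]
    refine intervalIntegral.integral_mono_on hδ.le (by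
      apply Continuous.intervalIntegrable
      fun_prop) (by
      apply Continuous.intervalIntegrable
      fun_prop) fun t ht => ?_
    have h3 : 0 ≤ δ⁻¹ * t := mul_nonneg (by positivity) ht.1
    have h4 : δ⁻¹ * t ≤ 1 := by
      rw [inv_mul_le_iff₀ hδ]
      simpa using ht.2
    have h5 : 0 < δ⁻¹ := by positivity
    nlinarith [sq_nonneg (w t + deriv w t), sq_nonneg (w t), sq_nonneg (deriv w t),
      mul_nonneg (sub_nonneg.2 h4) (sq_nonneg (w t + deriv w t)),
      mul_nonneg h3 (add_nonneg (sq_nonneg (w t)) (sq_nonneg (deriv w t))),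
      mul_nonneg h5.le (sq_nonneg (deriv w t))]
  rw [intervalIntegral.integral_of_le hδ.le, integral_const_mul] at hle
  refine (ENNReal.ofReal_le_ofReal hle).trans_eq ?_
  rw [ENNReal.ofReal_mul (by positivity), ofReal_integral_eq_lintegral_ofReal]
  · have : IntegrableOn (fun t => w t ^ 2 + deriv w t ^ 2) (Set.Icc 0 δ) :=
      (by fun_prop : Continuous fun t => w t ^ 2 + deriv w t ^ 2).continuousOn.integrableOn_Icc
    exact this.mono_set Set.Ioc_subset_Icc_self
  · exact Eventually.of_forall fun t => by positivity

/-- A coordinate system in which a surface is a graph. -/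
abbrev GraphChart : Type := E3 ≃ₗᵢ[ℝ] WithLp 2 (E2 × ℝ)

/-- The parametrization of the graph of `γ` in the coordinates `e`. -/
def graphMap (e : GraphChart) (γ : E2 → ℝ) (y : E2) : E3 := e.symm (WithLp.toLp 2 (y, γ y))

/-- The unit vector normal to the coordinate plane. -/
def upward (e : GraphChart) : E3 := e.symm (WithLp.toLp 2 (0, 1))

section Graph

variable (e : GraphChart) {K : ℝ≥0} {γ : E2 → ℝ}

theorem norm_upward : ‖upward e‖ = 1 := by
  rw [upward, e.symm.norm_map, WithLp.prod_norm_eq_of_L2]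
  simp

theorem graphMap_add_smul_upward (y : E2) (t : ℝ) :
    graphMap e γ y + t • upward e = e.symm (WithLp.toLp 2 (y, γ y + t)) := by
  rw [graphMap, upward, ← map_smul, ← map_add]
  congr 1
  rw [← WithLp.toLp_smul, ← WithLp.toLp_add]
  simp

theorem apply_graphMap_fst (y : E2) : (e (graphMap e γ y)).fst = y := by
  simp [graphMap]

theorem lipschitzWith_fst_chart : LipschitzWith 1 fun x : E3 => (e x).fst := by
  refine LipschitzWith.of_dist_le_mul fun x y => ?_
  rw [← e.dist_map x y, NNReal.coe_one, one_mul, WithLp.prod_dist_eq_of_L2]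
  refine Real.le_sqrt_of_sq_le ?_
  nlinarith [sq_nonneg (dist (e x).snd (e y).snd)]

theorem lipschitzWith_graphMap (hγ : LipschitzWith K γ) :
    LipschitzWith (1 + K) (graphMap e γ) := by
  refine LipschitzWith.of_dist_le_mul fun x y => ?_
  rw [graphMap, graphMap, e.symm.dist_map, WithLp.prod_dist_eq_of_L2, NNReal.coe_add,
    NNReal.coe_one]
  have h := hγ.dist_le_mul x y
  refine Real.sqrt_le_iff.2 ⟨by positivity, ?_⟩
  have h1 : dist (γ x) (γ y) ^ 2 ≤ (K * dist x y) ^ 2 := pow_le_pow_left₀ dist_nonneg h 2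
  have h2 : 0 ≤ K * dist x y * dist x y := by positivity
  change dist x y ^ 2 + dist (γ x) (γ y) ^ 2 ≤ _
  nlinarith

/-- The coordinates `(y, t) ↦ (y, γ y + t)` preserve the volume. -/
theorem measurePreserving_graph_shift (hγ : Continuous γ) :
    MeasurePreserving (fun p : E2 × ℝ => graphMap e γ p.1 + p.2 • upward e)
      (volume.prod volume) volume := by
  have h1 : MeasurePreserving (fun p : E2 × ℝ => (p.1, γ p.1 + p.2))
      (volume.prod volume) (volume.prod volume) := by
    refine (MeasurePreserving.id volume).skew_product (g := fun y t => γ y + t) ?_ ?_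
    · exact ((hγ.comp continuous_fst).add continuous_snd).measurable
    · exact Eventually.of_forall fun y => map_add_left_eq_self volume (γ y)
  have h2 := (e.symm.measurePreserving.comp (WithLp.volume_preserving_toLp E2 ℝ)).comp h1
  convert! h2 using 2 with p
  exact graphMap_add_smul_upward e p.1 p.2

/-- The one-dimensional estimate is integrated over segments of length `δ` that start on the graph
in the direction `upward e`. The parametrization costs a factor `(1 + K)²` in area, and the shear
`(y, t) ↦ (y, γ y + t)` preserves volume, so the double integral is an integral over space. The set
`Q` surrounds `S` on all sides, so it does not matter that the segments leave `D`. -/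
theorem lintegral_graph_le (hγ : LipschitzWith K γ) {S Q : Set E3} (hS : MeasurableSet S)
    {δ : ℝ} (hδ : 0 < δ) (hQ : MeasurableSet Q)
    (hSQ : ∀ x ∈ S, Metric.closedBall x δ ⊆ Q) {v : E3 → ℝ} (hv : ContDiff ℝ 1 v) :
    ∫⁻ x in S ∩ Set.range (graphMap e γ), ENNReal.ofReal (v x ^ 2) ∂(μHE[2] : Measure E3)
      ≤ ((1 + K : ℝ≥0) ^ 2 * ENNReal.ofReal (δ⁻¹ + 1)) *
        ∫⁻ x in Q, ENNReal.ofReal (v x ^ 2 + ‖gradient v x‖ ^ 2) := by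
  set F := graphMap e γ with hF
  set h : E3 → ℝ≥0∞ := fun x => ENNReal.ofReal (v x ^ 2 + ‖gradient v x‖ ^ 2) with hh
  have hg : Continuous (gradient v) :=
    (InnerProductSpace.toDual ℝ E3).symm.continuous.comp (hv.continuous_fderiv one_ne_zero)
  have hhm : Measurable h :=
    ((hv.continuous.pow 2).add (hg.norm.pow 2)).measurable.ennreal_ofReal
  have hFl := lipschitzWith_graphMap e hγ
  refine (hFl.setLIntegral_range_le 2 S (hv.continuous.pow 2).measurable.ennreal_ofReal).trans ?_
  rw [mul_assoc, EuclideanSpace.euclideanHausdorffMeasure_eq_volume]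
  refine mul_le_mul_right ?_ _
  have hline : ∀ y, ENNReal.ofReal (v (F y) ^ 2) ≤ ENNReal.ofReal (δ⁻¹ + 1) *
      ∫⁻ t in Set.Ioc 0 δ, h (F y + t • upward e) := by
    intro y
    have hw : ContDiff ℝ 1 fun t : ℝ => v (F y + t • upward e) :=
      hv.comp (contDiff_const.add (contDiff_id.smul contDiff_const))
    have h1 := ofReal_sq_le_lintegral hw hδ
    simp only [zero_smul, add_zero] at h1
    refine h1.trans (mul_le_mul_right (lintegral_mono fun t => ENNReal.ofReal_le_ofReal ?_) _)
    have h2 : HasDerivAt (fun t : ℝ => F y + t • upward e) (upward e) t := by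
      simpa using ((hasDerivAt_id t).smul_const (upward e)).const_add (F y)
    have h3 := ((hv.differentiable one_ne_zero (F y + t • upward e)).hasFDerivAt
      ).comp_hasDerivAt t h2
    have h4 : deriv (fun t : ℝ => v (F y + t • upward e)) t
        = fderiv ℝ v (F y + t • upward e) (upward e) := h3.deriv
    rw [h4]
    have h5 := (fderiv ℝ v (F y + t • upward e)).le_opNorm (upward e)
    rw [norm_upward, mul_one, Real.norm_eq_abs] at h5
    have h6 : ‖gradient v (F y + t • upward e)‖ = ‖fderiv ℝ v (F y + t • upward e)‖ :=
      (InnerProductSpace.toDual ℝ E3).symm.norm_map _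
    rw [h6]
    have := sq_le_sq' (by linarith [abs_le.1 h5]) (abs_le.1 h5).2
    linarith
  calc ∫⁻ y in F ⁻¹' S, ENNReal.ofReal (v (F y) ^ 2)
      ≤ ∫⁻ y in F ⁻¹' S, ENNReal.ofReal (δ⁻¹ + 1) *
          ∫⁻ t, Q.indicator h (F y + t • upward e) := by
        refine setLIntegral_mono' (hFl.continuous.measurable hS) fun y hy => ?_
        refine (hline y).trans (mul_le_mul_right ?_ _)
        rw [← lintegral_indicator measurableSet_Ioc]
        refine lintegral_mono fun t => ?_
        by_cases ht : t ∈ Set.Ioc 0 δ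
        · have hm : F y + t • upward e ∈ Q := by
            refine hSQ _ hy ?_
            rw [Metric.mem_closedBall, dist_eq_norm, add_sub_cancel_left, norm_smul, norm_upward,
              mul_one, Real.norm_eq_abs, abs_of_pos ht.1]
            exact ht.2
          rw [Set.indicator_of_mem ht, Set.indicator_of_mem hm]
        · rw [Set.indicator_of_notMem ht]
          exact zero_le
    _ ≤ ∫⁻ y, ENNReal.ofReal (δ⁻¹ + 1) * ∫⁻ t, Q.indicator h (F y + t • upward e) :=
        setLIntegral_le_lintegral _ _
    _ = ENNReal.ofReal (δ⁻¹ + 1) * ∫⁻ y, ∫⁻ t, Q.indicator h (F y + t • upward e) :=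
        lintegral_const_mul' _ _ ENNReal.ofReal_ne_top
    _ = ENNReal.ofReal (δ⁻¹ + 1) * ∫⁻ x in Q, h x := by
        have hmp := measurePreserving_graph_shift e hγ.continuous
        congr 1
        rw [← lintegral_indicator hQ, ← hmp.lintegral_comp (hhm.indicator hQ), lintegral_prod]
        exact ((hhm.indicator hQ).comp hmp.measurable).aemeasurable

end Graph

/-! ### Area and trace inequality for the boundary of a Lipschitz set. -/

section LipschitzBoundary

variable {D : Set E3}

/-- Strictly below and strictly above the graph are open conditions, so such points of `U` are
interior to `D` or outside its closure. A graph point is a limit of points of both kinds, whether or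
not it lies in `D`. -/
theorem IsLipschitzSet.exists_graph (hD : IsLipschitzSet D) {p : E3} (hp : p ∈ frontier D) :
    ∃ (U : Set E3) (e : GraphChart) (K : ℝ≥0) (γ : E2 → ℝ), IsOpen U ∧ p ∈ U ∧
      LipschitzWith K γ ∧ frontier D ∩ U = Set.range (graphMap e γ) ∩ U := by
  obtain ⟨U, e, K, γ, hU, hpU, hγ, h⟩ := hD p hp
  refine ⟨U, e, K, γ, hU, hpU, hγ, ?_⟩
  have hc1 : Continuous fun x => (e x).snd :=
    (WithLp.prod_continuous_ofLp 2 E2 ℝ).snd.comp e.continuous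
  have hc2 : Continuous fun x => γ (e x).fst :=
    hγ.continuous.comp (lipschitzWith_fst_chart e).continuous
  ext x
  refine and_congr_left fun hxU => ⟨fun hx => ?_, ?_⟩
  · have hx1 : (e x).snd = γ (e x).fst := by
      rcases lt_trichotomy (e x).snd (γ (e x).fst) with hlt | heq | hgt
      · refine absurd ?_ hx.2
        refine mem_interior.2 ⟨U ∩ {x | (e x).snd < γ (e x).fst}, fun z hz => (h z hz.1).1 hz.2,
          hU.inter (isOpen_lt hc1 hc2), hxU, hlt⟩
      · exact heq
      · obtain ⟨z, ⟨hzU, hz⟩, hzD⟩ := mem_closure_iff.1 hx.1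
          (U ∩ {x | γ (e x).fst < (e x).snd}) (hU.inter (isOpen_lt hc2 hc1)) ⟨hxU, hgt⟩
        exact absurd hzD ((h z hzU).2 hz)
    refine ⟨(e x).fst, ?_⟩
    rw [graphMap, ← hx1]
    exact e.symm_apply_apply x
  · rintro ⟨y, rfl⟩
    have hcont : Continuous fun t : ℝ => graphMap e γ y + t • upward e := by fun_prop
    have hev : ∀ᶠ t in 𝓝 (0 : ℝ), graphMap e γ y + t • upward e ∈ U := by
      refine hcont.continuousAt.eventually_mem (hU.mem_nhds ?_)
      simpa using hxU
    have htend : Tendsto (fun t : ℝ => graphMap e γ y + t • upward e) (𝓝 0)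
        (𝓝 (graphMap e γ y)) := by
      simpa using hcont.tendsto 0
    have hcoord : ∀ t : ℝ, (e (graphMap e γ y + t • upward e)).fst = y ∧
        (e (graphMap e γ y + t • upward e)).snd = γ y + t := by
      intro t
      rw [graphMap_add_smul_upward, e.apply_symm_apply]
      exact ⟨rfl, rfl⟩
    rw [frontier_eq_closure_inter_closure]
    constructor
    · refine mem_closure_of_tendsto (htend.mono_left (nhdsWithin_le_nhds (s := Set.Iio 0))) ?_
      filter_upwards [hev.filter_mono nhdsWithin_le_nhds, self_mem_nhdsWithin] with t ht hlt
      refine (h _ ht).1 ?_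
      rw [(hcoord t).1, (hcoord t).2]
      exact add_lt_of_neg_right _ hlt
    · refine mem_closure_of_tendsto (htend.mono_left (nhdsWithin_le_nhds (s := Set.Ioi 0))) ?_
      filter_upwards [hev.filter_mono nhdsWithin_le_nhds, self_mem_nhdsWithin] with t ht hlt
      refine (h _ ht).2 ?_
      rw [(hcoord t).1, (hcoord t).2]
      exact lt_add_of_pos_right _ hlt

/-- The boundary of a Lipschitz set has positive area. -/
theorem IsLipschitzSet.surfaceMeasure_pos (hD : IsLipschitzSet D)
    (hne : (frontier D).Nonempty) : 0 < surfaceMeasure (frontier D) Set.univ := by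
  obtain ⟨p, hp⟩ := hne
  obtain ⟨U, e, K, γ, hU, hpU, hγ, h⟩ := hD.exists_graph hp
  obtain ⟨y, hy⟩ : p ∈ Set.range (graphMap e γ) := (h.subset ⟨hp, hpU⟩).1
  have hA : IsOpen (graphMap e γ ⁻¹' U) := hU.preimage (lipschitzWith_graphMap e hγ).continuous
  have hpos : 0 < volume (graphMap e γ ⁻¹' U) :=
    hA.measure_pos _ ⟨y, by rwa [Set.mem_preimage, hy]⟩
  -- Orthogonal projection to the coordinate plane is 1-Lipschitz, so the boundary has at least the
  -- area of its shadow, which contains a nonempty open set.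
  have hle := (lipschitzWith_fst_chart e).euclideanHausdorffMeasure_image_le 2 (frontier D)
  rw [EuclideanSpace.euclideanHausdorffMeasure_eq_volume, ENNReal.coe_one, one_pow, one_mul] at hle
  rw [Measure.restrict_apply_univ]
  refine hpos.trans_le ((measure_mono fun z hz => ?_).trans hle)
  exact ⟨graphMap e γ z, (h.symm.subset ⟨⟨z, rfl⟩, hz⟩).1, apply_graphMap_fst e z⟩

/-- The trace inequality for smooth functions, in terms of squares. -/
theorem IsLipschitzSet.exists_lintegral_frontier_le (hD : IsLipschitzSet D)
    (hcomp : IsCompact (frontier D)) {Q : Set E3} (hQ : MeasurableSet Q) {δ : ℝ} (hδ : 0 < δ)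
    (hSQ : ∀ x ∈ frontier D, Metric.closedBall x δ ⊆ Q) :
    ∃ C : ℝ≥0, ∀ v : E3 → ℝ, ContDiff ℝ 1 v →
      ∫⁻ x, ENNReal.ofReal (v x ^ 2) ∂(surfaceMeasure (frontier D))
        ≤ C * ∫⁻ x in Q, ENNReal.ofReal (v x ^ 2 + ‖gradient v x‖ ^ 2) := by
  -- The boundary is doubled so that the induction over compact sets can shrink the second copy; on
  -- a union the constants add.
  suffices H : ∃ C : ℝ≥0, ∀ v : E3 → ℝ, ContDiff ℝ 1 v →
      ∫⁻ x in frontier D ∩ frontier D, ENNReal.ofReal (v x ^ 2) ∂(μHE[2] : Measure E3)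
        ≤ C * ∫⁻ x in Q, ENNReal.ofReal (v x ^ 2 + ‖gradient v x‖ ^ 2) by
    rwa [Set.inter_self] at H
  refine hcomp.induction_on (p := fun s => ∃ C : ℝ≥0, ∀ v : E3 → ℝ, ContDiff ℝ 1 v →
      ∫⁻ x in frontier D ∩ s, ENNReal.ofReal (v x ^ 2) ∂(μHE[2] : Measure E3)
        ≤ C * ∫⁻ x in Q, ENNReal.ofReal (v x ^ 2 + ‖gradient v x‖ ^ 2)) ?_ ?_ ?_ ?_
  · exact ⟨0, fun v _ => by simp⟩
  · rintro s t hst ⟨C, hC⟩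
    exact ⟨C, fun v hv => (lintegral_mono_set (Set.inter_subset_inter_right _ hst)).trans (hC v hv)⟩
  · rintro s t ⟨C, hC⟩ ⟨C', hC'⟩
    refine ⟨C + C', fun v hv => ?_⟩
    rw [Set.inter_union_distrib_left, ENNReal.coe_add, add_mul]
    exact (lintegral_union_le _ _ _).trans (add_le_add (hC v hv) (hC' v hv))
  · intro p hp
    obtain ⟨U, e, K, γ, hU, hpU, hγ, h⟩ := hD.exists_graph hp
    refine ⟨U, mem_nhdsWithin_of_mem_nhds (hU.mem_nhds hpU),
      (1 + K) ^ 2 * Real.toNNReal (δ⁻¹ + 1), fun v hv => ?_⟩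
    refine (lintegral_mono_set ?_).trans
      (lintegral_graph_le e hγ isClosed_frontier.measurableSet hδ hQ hSQ hv)
    exact fun x hx => ⟨hx.1, (h.subset hx).1⟩

/-- This is the trace inequality for the constant function `1` on a bounded neighbourhood of the
boundary. -/
theorem IsLipschitzSet.surfaceMeasure_lt_top (hD : IsLipschitzSet D)
    (hcomp : IsCompact (frontier D)) : surfaceMeasure (frontier D) Set.univ < ⊤ := by
  obtain ⟨C, hC⟩ := hD.exists_lintegral_frontier_le hcomp
    (Metric.isOpen_thickening (δ := 2) (E := frontier D)).measurableSet one_pos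
    fun x hx y hy => Metric.mem_thickening_iff.2 ⟨x, hx, hy.trans_lt one_lt_two⟩
  have h := hC (fun _ => 1) contDiff_const
  have hb : volume (Metric.thickening 2 (frontier D)) < ⊤ :=
    hcomp.isBounded.thickening.measure_lt_top
  simp only [gradient_fun_const', norm_zero, one_pow, zero_pow two_ne_zero, add_zero,
    ENNReal.ofReal_one, lintegral_one, Measure.restrict_apply_univ] at h
  rw [Measure.restrict_apply_univ]
  exact h.trans_lt (ENNReal.mul_lt_top ENNReal.coe_lt_top hb)

/-- The trace inequality for smooth functions. -/
theorem IsLipschitzSet.exists_eLpNorm_frontier_le (hD : IsLipschitzSet D)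
    (hcomp : IsCompact (frontier D)) {Q : Set E3} (hQ : MeasurableSet Q) {δ : ℝ} (hδ : 0 < δ)
    (hSQ : ∀ x ∈ frontier D, Metric.closedBall x δ ⊆ Q) :
    ∃ C : ℝ≥0, ∀ v : E3 → ℝ, ContDiff ℝ 1 v →
      eLpNorm v 2 (surfaceMeasure (frontier D))
        ≤ C * (eLpNorm v 2 (volume.restrict Q) + eLpNorm (gradient v) 2 (volume.restrict Q)) := by
  obtain ⟨C, hC⟩ := hD.exists_lintegral_frontier_le hcomp hQ hδ hSQ
  -- `C + 1` replaces the square root of `C`: its square dominates `C`. The two norms separate by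
  -- `a² + b² ≤ (a + b)²`.
  refine ⟨C + 1, fun v hv => ?_⟩
  have hsq : ∀ x, ENNReal.ofReal (v x ^ 2) = ‖v x‖ₑ ^ 2 := fun x => by
    rw [← sq_abs, ENNReal.ofReal_pow (abs_nonneg _), ← Real.enorm_eq_ofReal_abs]
  have hsq' : ∀ x, ENNReal.ofReal (v x ^ 2 + ‖gradient v x‖ ^ 2)
      = ‖v x‖ₑ ^ 2 + ‖gradient v x‖ₑ ^ 2 := fun x => by
    rw [ENNReal.ofReal_add (sq_nonneg _) (sq_nonneg _), hsq, ENNReal.ofReal_pow (norm_nonneg _),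
      ofReal_norm]
  have h := hC v hv
  simp only [hsq, hsq'] at h
  rw [lintegral_add_left (hv.continuous.enorm.measurable.pow_const 2), ← eLpNorm_two_sq,
    ← eLpNorm_two_sq, ← eLpNorm_two_sq] at h
  refine (ENNReal.pow_le_pow_left_iff two_ne_zero).1 (h.trans ?_)
  set a := eLpNorm v 2 (volume.restrict Q)
  set b := eLpNorm (gradient v) 2 (volume.restrict Q)
  rw [mul_pow]
  refine mul_le_mul' ?_ ?_
  · have : C ≤ (C + 1) ^ 2 := by nlinarith [zero_le (a := C)]
    exact_mod_cast this
  · rw [add_sq]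
    exact add_le_add_left le_self_add _

end LipschitzBoundary

/-! ### Three nested cubes with room between them. -/

section Cubes

/-- An open cube between `[-1, 1]³` and `Ω`. -/
def midCube : Set E3 := {x | ∀ i, x i ∈ Set.Ioo (-(11 / 10 : ℝ)) (11 / 10)}

theorem isOpen_cube (a b : ℝ) : IsOpen {x : E3 | ∀ i, x i ∈ Set.Ioo a b} := by
  simp only [Set.ofPred_forall]
  exact isOpen_iInter_of_finite fun i => isOpen_Ioo.preimage (EuclideanSpace.proj i).continuous

theorem isOpen_Omega : IsOpen Omega := isOpen_cube _ _

theorem isOpen_midCube : IsOpen midCube := isOpen_cube _ _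

theorem isClosed_unitCube : IsClosed unitCube := by
  simp only [unitCube, Set.ofPred_forall]
  exact isClosed_iInter fun i => isClosed_Icc.preimage (EuclideanSpace.proj i).continuous

theorem isBounded_Omega : Bornology.IsBounded Omega := by
  refine isBounded_iff_forall_norm_le.2 ⟨Real.sqrt (∑ _i : Fin 3, (6 / 5) ^ 2), fun x hx => ?_⟩
  rw [EuclideanSpace.norm_eq]
  refine Real.sqrt_le_sqrt (Finset.sum_le_sum fun i _ => ?_)
  exact pow_le_pow_left₀ (norm_nonneg _) (abs_le.2 ⟨(hx i).1.le, (hx i).2.le⟩) 2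

theorem abs_apply_sub_le_dist (x y : E3) (i : Fin 3) : |x i - y i| ≤ dist x y := by
  rw [dist_eq_norm]
  exact PiLp.norm_apply_le (x - y) i

/-- Successive cubes are `1/10` apart, so `1/20` fits into both gaps. In the inner gap it is the
segment length of the trace inequality, in the outer one the bound on the mollification radius. -/
theorem closedBall_subset_midCube {x : E3} (hx : x ∈ unitCube) :
    Metric.closedBall x (1 / 20) ⊆ midCube := by
  intro y hy i
  have h1 := abs_le.1 ((abs_apply_sub_le_dist y x i).trans hy)
  have h2 := hx i
  constructor <;> linarith [h1.1, h1.2, h2.1, h2.2]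

theorem unitCube_subset_midCube : unitCube ⊆ midCube := fun x hx =>
  closedBall_subset_midCube hx (Metric.mem_closedBall_self (by norm_num))

theorem closedBall_subset_Omega {x : E3} (hx : x ∈ midCube) :
    Metric.closedBall x (1 / 20) ⊆ Omega := by
  intro y hy i
  have h1 := abs_le.1 ((abs_apply_sub_le_dist y x i).trans hy)
  have h2 := hx i
  constructor <;> linarith [h1.1, h1.2, h2.1, h2.2]

theorem midCube_subset_Omega : midCube ⊆ Omega := fun x hx =>
  closedBall_subset_Omega hx (Metric.mem_closedBall_self (by norm_num))

/-- A continuous function is in every `L^p` of a finite measure on a bounded set. -/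
theorem memLp_restrict_of_continuous {F : Type*} [NormedAddCommGroup F] {μ : Measure E3}
    {s : Set E3} (hs : Bornology.IsBounded s) (hm : MeasurableSet s) [IsFiniteMeasure (μ.restrict s)]
    {p : ℝ≥0∞} {f : E3 → F} (hf : Continuous f) : MemLp f p (μ.restrict s) := by
  obtain ⟨C, hC⟩ := hs.isCompact_closure.exists_bound_of_continuousOn hf.continuousOn
  refine MemLp.of_bound hf.aestronglyMeasurable C ?_
  filter_upwards [ae_restrict_mem hm] with x hx
  exact hC x (subset_closure hx)

instance isFiniteMeasure_volOmega : IsFiniteMeasure volOmega :=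
  ⟨by simpa using isBounded_Omega.measure_lt_top⟩

end Cubes

/-! ### Mollification of functions on `Omega` and of their weak gradients. -/

theorem continuous_gradient {v : E3 → ℝ} (hv : ContDiff ℝ 1 v) : Continuous (gradient v) :=
  (InnerProductSpace.toDual ℝ E3).symm.continuous.comp (hv.continuous_fderiv one_ne_zero)

theorem gradient_apply (v : E3 → ℝ) (x : E3) (i : Fin 3) :
    gradient v x i = fderiv ℝ v x (EuclideanSpace.single i 1) := by
  rw [← inner_gradient_left, EuclideanSpace.inner_single_right]
  simp

theorem gradient_sub {v w : E3 → ℝ} {x : E3} (hv : DifferentiableAt ℝ v x)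
    (hw : DifferentiableAt ℝ w x) : gradient (v - w) x = gradient v x - gradient w x := by
  rw [gradient, fderiv_sub hv hw, map_sub]
  rfl

section Mollify

variable {F : Type*} [NormedAddCommGroup F]

/-- Bump functions whose supports shrink to the origin. -/
def bump (n : ℕ) : ContDiffBump (0 : E3) where
  rIn := 1 / 40 * (1 / ((n : ℝ) + 1))
  rOut := 1 / 20 * (1 / ((n : ℝ) + 1))
  rIn_pos := by positivity
  rIn_lt_rOut := mul_lt_mul_of_pos_right (by norm_num) (by positivity)

theorem bump_rOut_le (n : ℕ) : (bump n).rOut ≤ 1 / 20 := by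
  have h : 1 / ((n : ℝ) + 1) ≤ 1 := by
    rw [div_le_one (by positivity)]
    linarith [(Nat.cast_nonneg n : (0 : ℝ) ≤ n)]
  change 1 / 20 * (1 / ((n : ℝ) + 1)) ≤ _
  linarith

theorem tendsto_bump_rOut : Tendsto (fun n => (bump n).rOut) atTop (𝓝 0) := by
  have h := (tendsto_one_div_add_atTop_nhds_zero_nat (𝕜 := ℝ)).const_mul (1 / 20)
  rwa [mul_zero] at h

theorem memLp_indicator_Omega {p : ℝ≥0∞} {f : E3 → F} (hf : MemLp f p volOmega) :
    MemLp (Omega.indicator f) p volume :=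
  (memLp_indicator_iff_restrict isOpen_Omega.measurableSet).2 hf

theorem locallyIntegrable_indicator_Omega {f : E3 → F} (hf : MemLp f 2 volOmega) :
    LocallyIntegrable (Omega.indicator f) volume :=
  (memLp_indicator_Omega hf).locallyIntegrable (by norm_num)

variable [NormedSpace ℝ F]

/-- Mollification of the extension by zero of a function on `Ω`. -/
def mollify (n : ℕ) (f : E3 → F) : E3 → F :=
  (bump n).normed volume ⋆[ContinuousLinearMap.lsmul ℝ ℝ, volume] Omega.indicator f

/-- Equality holds at every point, not only almost everywhere. This is what allows an `L²` class to
be mollified and then restricted to a surface of volume zero. -/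
theorem mollify_congr (n : ℕ) {f g : E3 → F} (h : f =ᵐ[volOmega] g) : mollify n f = mollify n g :=
  convolution_congr _ EventuallyEq.rfl
    ((ae_eq_restrict_iff_indicator_ae_eq isOpen_Omega.measurableSet).1 h)

theorem mollify_add (n : ℕ) {f g : E3 → F} (hf : MemLp f 2 volOmega) (hg : MemLp g 2 volOmega) :
    mollify n (f + g) = mollify n f + mollify n g := by
  have h : ∀ {f : E3 → F}, MemLp f 2 volOmega → ConvolutionExists ((bump n).normed volume)
      (Omega.indicator f) (ContinuousLinearMap.lsmul ℝ ℝ) volume := fun hf =>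
    (bump n).hasCompactSupport_normed.convolutionExists_left _ (bump n).continuous_normed
      (locallyIntegrable_indicator_Omega hf)
  rw [mollify, Set.indicator_add']
  exact (h hf).distrib_add (h hg)

theorem mollify_smul (n : ℕ) (c : ℝ) (f : E3 → F) : mollify n (c • f) = c • mollify n f := by
  have : Omega.indicator (c • f) = c • Omega.indicator f := by
    ext1 x
    exact Set.indicator_const_smul_apply Omega c f x
  rw [mollify, this]
  exact convolution_smul

theorem contDiff_mollify (n : ℕ) {f : E3 → F} (hf : MemLp f 2 volOmega) :
    ContDiff ℝ ∞ (mollify n f) :=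
  (bump n).hasCompactSupport_normed.contDiff_convolution_left _
    ((bump n).contDiff_normed (n := ⊤)) (locallyIntegrable_indicator_Omega hf)

/-- The error of the mollification. -/
def mollifyError (n : ℕ) (f : E3 → F) : ℝ≥0∞ :=
  eLpNorm (mollify n f - Omega.indicator f) 2 volume

theorem tendsto_mollifyError [CompleteSpace F] {f : E3 → F} (hf : MemLp f 2 volOmega) :
    Tendsto (fun n => mollifyError n f) atTop (𝓝 0) :=
  tendsto_eLpNorm_convolution_sub tendsto_bump_rOut (memLp_indicator_Omega hf)

theorem aestronglyMeasurable_mollify_sub (n : ℕ) {f : E3 → F} (hf : MemLp f 2 volOmega) :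
    AEStronglyMeasurable (mollify n f - Omega.indicator f) volume :=
  (contDiff_mollify n hf).continuous.aestronglyMeasurable.sub (memLp_indicator_Omega hf).1

theorem eLpNorm_mollify_sub_mollify_le (n m : ℕ) {f : E3 → F} (hf : MemLp f 2 volOmega) :
    eLpNorm (mollify n f - mollify m f) 2 volume ≤ mollifyError n f + mollifyError m f := by
  have h : mollify n f - mollify m f
      = (mollify n f - Omega.indicator f) - (mollify m f - Omega.indicator f) := by
    abel
  rw [h]
  exact eLpNorm_sub_le (aestronglyMeasurable_mollify_sub n hf)
    (aestronglyMeasurable_mollify_sub m hf) (by norm_num)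

theorem eLpNorm_mollify_le (n : ℕ) {f : E3 → F} (hf : MemLp f 2 volOmega) :
    eLpNorm (mollify n f) 2 volume ≤ mollifyError n f + eLpNorm f 2 volOmega := by
  have h : mollify n f = (mollify n f - Omega.indicator f) + Omega.indicator f := by
    abel
  rw [← eLpNorm_indicator_eq_eLpNorm_restrict isOpen_Omega.measurableSet]
  calc eLpNorm (mollify n f) 2 volume
      = eLpNorm ((mollify n f - Omega.indicator f) + Omega.indicator f) 2 volume := by rw [← h]
    _ ≤ _ := eLpNorm_add_le (aestronglyMeasurable_mollify_sub n hf) (memLp_indicator_Omega hf).1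
      (by norm_num)

/-- Mollifications converge at points of continuity. -/
theorem tendsto_mollify [CompleteSpace F] {f : E3 → F} (hf : AEStronglyMeasurable f volOmega) {x : E3}
    (hx : x ∈ Omega) (hc : ContinuousAt f x) :
    Tendsto (fun n => mollify n f x) atTop (𝓝 (f x)) := by
  refine ContDiffBump.convolution_tendsto_right (g := fun _ => Omega.indicator f) (k := fun _ => x)
    tendsto_bump_rOut (Eventually.of_forall fun _ =>
      (aestronglyMeasurable_indicator_iff isOpen_Omega.measurableSet).2 hf) ?_ tendsto_const_nhds
  have h : Tendsto (Omega.indicator f) (𝓝 x) (𝓝 (f x)) := by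
    refine hc.tendsto.congr' ?_
    filter_upwards [isOpen_Omega.mem_nhds hx] with y hy
    rw [Set.indicator_of_mem hy]
  exact h.comp tendsto_snd

/-- In the interior of `Ω`, mollification commutes with the weak gradient. -/
theorem gradient_mollify (n : ℕ) {u : E3 → ℝ} {G : E3 → E3} (hu : MemLp u 2 volOmega)
    (hG : MemLp G 2 volOmega) (h : IsWeakGradient u G) {x : E3} (hx : x ∈ midCube) :
    gradient (mollify n u) x = mollify n G x := by
  set ρ : E3 → ℝ := (bump n).normed volume with hρ
  have hρs : ContDiff ℝ ∞ ρ := (bump n).contDiff_normed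
  have hρc : HasCompactSupport ρ := (bump n).hasCompactSupport_normed
  have hd : Continuous (fderiv ℝ ρ) := hρs.continuous_fderiv (by simp)
  -- The reflected kernel centred at `x` is an admissible test function, because `x` keeps distance
  -- `1/20` from the complement of `Omega`. The sign from the reflection cancels the one in the
  -- definition of the weak gradient.
  set φ : E3 → ℝ := fun y => ρ (x - y) with hφ
  have hφs : ContDiff ℝ ∞ φ := hρs.comp (contDiff_const.sub contDiff_id)
  have hφsupp : tsupport φ ⊆ Metric.closedBall x (1 / 20) := by
    refine closure_minimal (fun y hy => ?_) Metric.isClosed_closedBall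
    have h1 : x - y ∈ Function.support ρ := hy
    rw [hρ, (bump n).support_normed_eq, mem_ball_zero_iff, ← dist_eq_norm, dist_comm] at h1
    exact h1.le.trans (bump_rOut_le n)
  have hφc : HasCompactSupport φ :=
    (isCompact_closedBall x (1 / 20)).of_isClosed_subset (isClosed_tsupport φ) hφsupp
  ext i
  have hder := (hρc.hasFDerivAt_convolution_left (ContinuousLinearMap.lsmul ℝ ℝ)
    (hρs.of_le (by simp)) (locallyIntegrable_indicator_Omega hu) x).fderiv
  have hex := (hρc.fderiv ℝ).convolutionExists_left
    ((ContinuousLinearMap.lsmul ℝ ℝ : ℝ →L[ℝ] ℝ →L[ℝ] ℝ).precompL E3) hd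
    (locallyIntegrable_indicator_Omega hu) x
  have hexG : Integrable (fun t => ρ t • Omega.indicator G (x - t)) volume :=
    hρc.convolutionExists_left (ContinuousLinearMap.lsmul ℝ ℝ) hρs.continuous
      (locallyIntegrable_indicator_Omega hG) x
  have hφd : ∀ y, fderiv ℝ φ y (EuclideanSpace.single i 1)
      = -(fderiv ℝ ρ (x - y) (EuclideanSpace.single i 1)) := by
    intro y
    have h1 : HasFDerivAt (fun y : E3 => x - y) (-ContinuousLinearMap.id ℝ E3) y := by
      simpa using (hasFDerivAt_id y).const_sub x
    have h2 := ((hρs.differentiable (by simp) (x - y)).hasFDerivAt.comp y h1).fderiv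
    change fderiv ℝ (ρ ∘ fun y => x - y) y _ = _
    rw [h2]
    simp
  have h1 : gradient (mollify n u) x i
      = -∫ y in Omega, u y * fderiv ℝ φ y (EuclideanSpace.single i 1) := by
    rw [gradient_apply]
    calc fderiv ℝ (mollify n u) x (EuclideanSpace.single i 1)
        = ((fderiv ℝ ρ ⋆[(ContinuousLinearMap.lsmul ℝ ℝ : ℝ →L[ℝ] ℝ →L[ℝ] ℝ).precompL E3, volume]
            Omega.indicator u) x) (EuclideanSpace.single i 1) := by rw [← hder]; rfl
      _ = ∫ t, fderiv ℝ ρ t (EuclideanSpace.single i 1) * Omega.indicator u (x - t) := by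
          rw [convolution_def, ContinuousLinearMap.integral_apply hex]
          rfl
      _ = ∫ y, fderiv ℝ ρ (x - y) (EuclideanSpace.single i 1) * Omega.indicator u y := by
          rw [← integral_sub_left_eq_self _ volume x]
          simp only [sub_sub_cancel]
      _ = ∫ y, Omega.indicator (fun y => -(u y * fderiv ℝ φ y (EuclideanSpace.single i 1))) y := by
          refine integral_congr_ae (Eventually.of_forall fun y => ?_)
          by_cases hy : y ∈ Omega
          · simp only [Set.indicator_of_mem hy, hφd]
            ring
          · simp only [Set.indicator_of_notMem hy, mul_zero]
      _ = _ := by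
          rw [integral_indicator isOpen_Omega.measurableSet, integral_neg]
  have h2 : mollify n G x i = ∫ y in Omega, G y i * φ y := by
    calc mollify n G x i = ∫ t, ρ t * Omega.indicator G (x - t) i :=
          ((EuclideanSpace.proj i : E3 →L[ℝ] ℝ).integral_comp_comm hexG).symm
      _ = ∫ y, ρ (x - y) * Omega.indicator G y i := by
          rw [← integral_sub_left_eq_self _ volume x]
          simp only [sub_sub_cancel]
      _ = ∫ y, Omega.indicator (fun y => G y i * φ y) y := by
          refine integral_congr_ae (Eventually.of_forall fun y => ?_)
          by_cases hy : y ∈ Omega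
          · simp only [Set.indicator_of_mem hy]
            ring
          · simp [Set.indicator_of_notMem hy]
      _ = _ := integral_indicator isOpen_Omega.measurableSet
  rw [h1, h2, h φ hφs hφc (hφsupp.trans (closedBall_subset_Omega hx)) i, neg_neg]

end Mollify

/-! ### Calculus of weak gradients. -/

section WeakGradient

variable {u : E3 → ℝ} {G : E3 → E3}

theorem memLp_apply {μ : Measure E3} (hG : MemLp G 2 μ) (i : Fin 3) :
    MemLp (fun x => G x i) 2 μ :=
  (EuclideanSpace.proj i : E3 →L[ℝ] ℝ).comp_memLp' hG

theorem IsWeakGradient.congr (h : IsWeakGradient u G) {u' : E3 → ℝ} {G' : E3 → E3}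
    (hu : u =ᵐ[volOmega] u') (hG : G =ᵐ[volOmega] G') : IsWeakGradient u' G' := by
  intro φ h1 h2 h3 i
  have e1 : ∫ x in Omega, u' x * fderiv ℝ φ x (EuclideanSpace.single i 1)
      = ∫ x in Omega, u x * fderiv ℝ φ x (EuclideanSpace.single i 1) := by
    refine integral_congr_ae ?_
    filter_upwards [hu] with x hx
    rw [hx]
  have e2 : ∫ x in Omega, G' x i * φ x = ∫ x in Omega, G x i * φ x := by
    refine integral_congr_ae ?_
    filter_upwards [hG] with x hx
    rw [hx]
  rw [e1, e2, h φ h1 h2 h3 i]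

theorem IsWeakGradient.sub (h : IsWeakGradient u G) {u' : E3 → ℝ} {G' : E3 → E3}
    (h' : IsWeakGradient u' G') (hu : MemLp u 2 volOmega) (hG : MemLp G 2 volOmega)
    (hu' : MemLp u' 2 volOmega) (hG' : MemLp G' 2 volOmega) :
    IsWeakGradient (u - u') (G - G') := by
  intro φ h1 h2 h3 i
  have hd := memLp_test_fderiv h1 h2 (EuclideanSpace.single i 1)
  have hφ := memLp_test h1.continuous h2
  have e1 := integral_sub (hu.integrable_mul hd) (hu'.integrable_mul hd)
  have e2 := integral_sub ((memLp_apply hG i).integrable_mul hφ)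
    ((memLp_apply hG' i).integrable_mul hφ)
  simp only [Pi.mul_apply, ← sub_mul] at e1 e2
  simp only [Pi.sub_apply, PiLp.sub_apply]
  rw [e1, e2, h φ h1 h2 h3 i, h' φ h1 h2 h3 i]
  ring

/-- The gradient of a `C¹` function is its weak gradient. -/
theorem isWeakGradient_gradient {v : E3 → ℝ} (hv : ContDiff ℝ 1 v) :
    IsWeakGradient v (gradient v) := by
  intro φ h1 h2 h3 i
  have hd : Continuous fun x => fderiv ℝ φ x (EuclideanSpace.single i 1) :=
    (h1.continuous_fderiv (by simp)).clm_apply continuous_const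
  have hvd : Continuous fun x => fderiv ℝ v x (EuclideanSpace.single i 1) :=
    (hv.continuous_fderiv one_ne_zero).clm_apply continuous_const
  have hdc : HasCompactSupport fun x => fderiv ℝ φ x (EuclideanSpace.single i 1) :=
    h2.fderiv_apply ℝ _
  -- The test function vanishes outside `Omega`, so both integrals extend to the whole space and no
  -- boundary term arises.
  have e1 : ∫ x in Omega, v x * fderiv ℝ φ x (EuclideanSpace.single i 1)
      = ∫ x, v x * fderiv ℝ φ x (EuclideanSpace.single i 1) := by
    refine setIntegral_eq_integral_of_forall_compl_eq_zero fun x hx => ?_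
    have : fderiv ℝ φ x = 0 := by
      by_contra hne
      exact hx (h3 (support_fderiv_subset ℝ hne))
    rw [this, zero_apply, mul_zero]
  have e2 : ∫ x in Omega, gradient v x i * φ x
      = ∫ x, fderiv ℝ v x (EuclideanSpace.single i 1) * φ x := by
    simp only [gradient_apply]
    refine setIntegral_eq_integral_of_forall_compl_eq_zero fun x hx => ?_
    rw [image_eq_zero_of_notMem_tsupport fun hm => hx (h3 hm), mul_zero]
  rw [e1, e2]
  exact integral_mul_fderiv_eq_neg_fderiv_mul_of_integrable
    ((hvd.mul h1.continuous).integrable_of_hasCompactSupport h2.mul_left)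
    ((hv.continuous.mul hd).integrable_of_hasCompactSupport hdc.mul_left)
    ((hv.continuous.mul h1.continuous).integrable_of_hasCompactSupport h2.mul_left)
    (fun x _ => hv.differentiable one_ne_zero x) (fun x _ => h1.differentiable (by simp) x)

/-- The Leibniz rule for the product with a smooth function. -/
theorem IsWeakGradient.smooth_mul (h : IsWeakGradient u G) (hu : MemLp u 2 volOmega)
    (hG : MemLp G 2 volOmega) {χ : E3 → ℝ} (hχ : ContDiff ℝ ∞ χ) :
    IsWeakGradient (fun x => χ x * u x) (fun x => χ x • G x + u x • gradient χ x) := by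
  intro φ h1 h2 h3 i
  -- The product `χ φ` is again a test function; the weak gradient of `u` is tested with it and the
  -- product rule separates the terms.
  have hχφ : ContDiff ℝ ∞ fun x => χ x * φ x := hχ.mul h1
  have hχφc : HasCompactSupport fun x => χ x * φ x := h2.mul_left
  have key := h _ hχφ hχφc ((closure_mono fun x hx => right_ne_zero_of_mul hx).trans h3) i
  have hder : ∀ x, fderiv ℝ (fun x => χ x * φ x) x (EuclideanSpace.single i 1)
      = χ x * fderiv ℝ φ x (EuclideanSpace.single i 1) + φ x * gradient χ x i := by
    intro x
    have := fderiv_mul (hχ.differentiable (by simp) x) (h1.differentiable (by simp) x)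
    rw [gradient_apply]
    change fderiv ℝ (χ * φ) x _ = _
    rw [this]
    simp
  have hg : Continuous fun x => φ x * gradient χ x i := by
    simp only [gradient_apply]
    exact h1.continuous.mul ((hχ.continuous_fderiv (by simp)).clm_apply continuous_const)
  have hd : Continuous fun x => χ x * fderiv ℝ φ x (EuclideanSpace.single i 1) :=
    hχ.continuous.mul ((h1.continuous_fderiv (by simp)).clm_apply continuous_const)
  have i1 := hu.integrable_mul (memLp_test hd (h2.fderiv_apply ℝ _).mul_left)
  have i2 := hu.integrable_mul (memLp_test hg h2.mul_right)
  have i3 := (memLp_apply hG i).integrable_mul (memLp_test hχφ.continuous hχφc)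
  have e1 : ∫ x in Omega, u x * fderiv ℝ (fun x => χ x * φ x) x (EuclideanSpace.single i 1)
      = (∫ x in Omega, u x * (χ x * fderiv ℝ φ x (EuclideanSpace.single i 1)))
        + ∫ x in Omega, u x * (φ x * gradient χ x i) := by
    refine Eq.trans ?_ (integral_add i1 i2)
    simp only [hder, mul_add]
  have e2 : ∫ x in Omega, (χ x • G x + u x • gradient χ x) i * φ x
      = (∫ x in Omega, G x i * (χ x * φ x)) + ∫ x in Omega, u x * (φ x * gradient χ x i) := by
    refine Eq.trans ?_ (integral_add i3 i2)
    refine integral_congr_ae (Eventually.of_forall fun x => ?_)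
    simp only [PiLp.add_apply, PiLp.smul_apply, smul_eq_mul]
    ring
  have e3 : ∫ x in Omega, χ x * u x * fderiv ℝ φ x (EuclideanSpace.single i 1)
      = ∫ x in Omega, u x * (χ x * fderiv ℝ φ x (EuclideanSpace.single i 1)) := by
    refine integral_congr_ae (Eventually.of_forall fun x => ?_)
    ring
  rw [e2, e3]
  rw [e1] at key
  linarith

end WeakGradient

/-! ### Minimization of coercive quadratic functionals. -/

section LaxMilgram

variable {V : Type*} [NormedAddCommGroup V] [InnerProductSpace ℝ V] [CompleteSpace V]
  {B : V →L[ℝ] V →L[ℝ] ℝ}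

/-- The quadratic functional of a symmetric coercive form has a unique minimizer, and its first
variation vanishes there. -/
theorem _root_.IsCoercive.exists_unique_minimizer (hB : IsCoercive B)
    (hsymm : ∀ u v, B u v = B v u) (l : V →L[ℝ] ℝ) :
    ∃ u : V,
      (∀ v, B u u - 2 * l u ≤ B v v - 2 * l v) ∧
      (∀ w, (∀ v, B w w - 2 * l w ≤ B v v - 2 * l v) → w = u) ∧
      (∀ θ : V, HasDerivAt (fun s : ℝ => B (u + s • θ) (u + s • θ) - 2 * l (u + s • θ)) 0 0) ∧
      ∀ θ, B u θ = l θ := by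
  obtain ⟨c, hc, hcB⟩ := id hB
  let A := hB.continuousLinearEquivOfBilin
  let u : V := A.symm ((InnerProductSpace.toDual ℝ V).symm l)
  have hu : ∀ θ, B u θ = l θ := by
    intro θ
    rw [← hB.continuousLinearEquivOfBilin_apply]
    change inner ℝ (A (A.symm _)) θ = _
    rw [A.apply_symm_apply, InnerProductSpace.toDual_symm_apply]
  -- Completing the square: the linear terms cancel because `B u θ = l θ` and `B` is symmetric. All
  -- claims about minimizers and the derivative follow from this identity.
  have hadd : ∀ θ, B (u + θ) (u + θ) - 2 * l (u + θ) = B u u - 2 * l u + B θ θ := by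
    intro θ
    rw [l.map_add, ← hu θ, B.map_add, add_apply, (B u).map_add, (B θ).map_add, hsymm θ u]
    ring
  have hE : ∀ v, B v v - 2 * l v = B u u - 2 * l u + B (v - u) (v - u) := by
    intro v
    rw [← hadd, add_sub_cancel]
  refine ⟨u, fun v => ?_, fun w hw => ?_, fun θ => ?_, hu⟩
  · rw [hE v]
    exact le_add_of_nonneg_right ((by positivity : 0 ≤ c * ‖v - u‖ * ‖v - u‖).trans (hcB _))
  · have h := hw u
    rw [hE w] at h
    have h1 := hcB (w - u)
    have h2 : c * (‖w - u‖ * ‖w - u‖) ≤ 0 := by linarith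
    have h3 := nonpos_of_mul_nonpos_right h2 hc
    have h4 := mul_self_eq_zero.1 (le_antisymm h3 (mul_self_nonneg _))
    exact sub_eq_zero.1 (norm_eq_zero.1 h4)
  · have e : (fun s : ℝ => B (u + s • θ) (u + s • θ) - 2 * l (u + s • θ))
        = fun s => B u u - 2 * l u + s ^ 2 * B θ θ := by
      ext s
      rw [hadd]
      simp only [map_smul, smul_apply, smul_eq_mul]
      ring
    rw [e]
    simpa using ((hasDerivAt_pow 2 (0 : ℝ)).mul_const (B θ θ)).const_add (B u u - 2 * l u)

end LaxMilgram

/-! ### `H1` as a Hilbert space and the bilinear form of the time step. -/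

theorem continuous_integral_coeFn_mul {α : Type*} [MeasurableSpace α] {μ : Measure α}
    {g : α → ℝ} (hg : MemLp g 2 μ) :
    Continuous fun f : Lp ℝ 2 μ => ∫ x, f x * g x ∂μ := by
  have : (fun f : Lp ℝ 2 μ => ∫ x, f x * g x ∂μ) = fun f => inner ℝ (hg.toLp g) f := by
    ext f
    rw [L2.inner_def]
    refine integral_congr_ae ?_
    filter_upwards [hg.coeFn_toLp] with x hx
    simp [hx]
  rw [this]
  fun_prop

/-- For each test function and coordinate the defining identity equates two continuous functionals,
so `H1` is an intersection of closed sets. The resulting completeness is what Lax-Milgram requires.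
-/
theorem isClosed_H1 : IsClosed (H1 : Set (WithLp 2 (Lp ℝ 2 volOmega × Lp E3 2 volOmega))) := by
  have : (H1 : Set (WithLp 2 (Lp ℝ 2 volOmega × Lp E3 2 volOmega)))
      = {p | IsWeakGradient p.fst p.snd} := rfl
  rw [this]
  unfold IsWeakGradient
  simp only [Set.ofPred_forall]
  refine isClosed_iInter fun φ => isClosed_iInter fun h1 => isClosed_iInter fun h2 =>
    isClosed_iInter fun _ => isClosed_iInter fun i => isClosed_eq ?_ (Continuous.neg ?_)
  · exact (continuous_integral_coeFn_mul (memLp_test_fderiv h1 h2 _)).comp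
      (WithLp.prod_continuous_ofLp 2 _ _).fst
  · have hp := (continuous_integral_coeFn_mul (memLp_test h1.continuous h2)).comp
      (((EuclideanSpace.proj i : E3 →L[ℝ] ℝ).compLpL 2 volOmega).continuous.comp
        (WithLp.prod_continuous_ofLp 2 (Lp ℝ 2 volOmega) (Lp E3 2 volOmega)).snd)
    refine hp.congr fun p => integral_congr_ae ?_
    filter_upwards [(EuclideanSpace.proj i : E3 →L[ℝ] ℝ).coeFn_compLp p.snd] with x hx
    have : ((EuclideanSpace.proj i : E3 →L[ℝ] ℝ).compLp p.snd) x = p.snd x i := hx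
    rw [← this]
    rfl

instance completeSpace_H1 : CompleteSpace H1 := isClosed_H1.completeSpace_coe

/-- The embedding of `H¹(Ω)` into `L²(Ω)`. -/
def H1.valL : H1 →L[ℝ] Lp ℝ 2 volOmega := WithLp.fstL 2 ℝ _ _ ∘L H1.subtypeL

/-- The weak gradient as a bounded operator. -/
def H1.gradL : H1 →L[ℝ] Lp E3 2 volOmega := WithLp.sndL 2 ℝ _ _ ∘L H1.subtypeL

theorem H1.norm_sq (u : H1) : ‖u‖ ^ 2 = ‖H1.val u‖ ^ 2 + ‖H1.grad u‖ ^ 2 :=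
  WithLp.prod_norm_sq_eq_of_L2 (u : WithLp 2 (Lp ℝ 2 volOmega × Lp E3 2 volOmega))

/-- The bilinear form of the backward Euler step. -/
def stepForm (τ : ℝ) : H1 →L[ℝ] H1 →L[ℝ] ℝ :=
  (innerSL ℝ).bilinearComp H1.valL H1.valL + τ • (innerSL ℝ).bilinearComp H1.gradL H1.gradL

theorem stepForm_apply (τ : ℝ) (u v : H1) :
    stepForm τ u v = inner ℝ (H1.val u) (H1.val v) + τ * inner ℝ (H1.grad u) (H1.grad v) := rfl

theorem stepForm_comm (τ : ℝ) (u v : H1) : stepForm τ u v = stepForm τ v u := by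
  rw [stepForm_apply, stepForm_apply, real_inner_comm, real_inner_comm (H1.grad u)]

theorem stepForm_self (τ : ℝ) (u : H1) :
    stepForm τ u u = ‖H1.val u‖ ^ 2 + τ * ‖H1.grad u‖ ^ 2 := by
  rw [stepForm_apply, real_inner_self_eq_norm_sq, real_inner_self_eq_norm_sq]

theorem min_mul_norm_sq_le_stepForm (τ : ℝ) (u : H1) :
    min 1 τ * ‖u‖ ^ 2 ≤ stepForm τ u u := by
  rw [stepForm_self, H1.norm_sq, mul_add]
  refine add_le_add ?_ (mul_le_mul_of_nonneg_right (min_le_right _ _) (sq_nonneg _))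
  exact (mul_le_mul_of_nonneg_right (min_le_left _ _) (sq_nonneg _)).trans_eq (one_mul _)

theorem isCoercive_stepForm {τ : ℝ} (hτ : 0 < τ) : IsCoercive (stepForm τ) :=
  ⟨min 1 τ, lt_min one_pos hτ, fun u => by
    rw [mul_assoc, ← sq]
    exact min_mul_norm_sq_le_stepForm τ u⟩

/-! ### The energy as a quadratic functional. -/

section Energy

variable {S : Set E3} [IsFiniteMeasure (surfaceMeasure S)]

variable (S) in
/-- The mean over `S` as a bounded functional on `L²(S)`. -/
def surfaceMeanL : Lp ℝ 2 (surfaceMeasure S) →L[ℝ] ℝ :=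
  (∫ _x, (1 : ℝ) ∂(surfaceMeasure S))⁻¹ •
    -- Finite area puts the constant `1` into `L²(S)`, so integration over `S` is an inner product
    -- and hence bounded.
    innerSL ℝ (indicatorConstLp 2 MeasurableSet.univ (measure_ne_top _ _) (1 : ℝ))

theorem surfaceMeanL_apply (g : Lp ℝ 2 (surfaceMeasure S)) :
    surfaceMeanL S g = surfaceMean S g := by
  have := L2.inner_indicatorConstLp_one (𝕜 := ℝ) MeasurableSet.univ
    (measure_ne_top (surfaceMeasure S) Set.univ) g
  rw [setIntegral_univ] at this
  rw [surfaceMean, ← this]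
  rfl

variable (T : H1 →L[ℝ] Lp ℝ 2 (surfaceMeasure S)) (τ : ℝ)

theorem energy_eq (u : H1) :
    energy S T τ u = stepForm τ u u - 2 * (surfaceMeanL S ∘L T) u := by
  have h1 : ∫ x in Omega, (H1.val u x) ^ 2 = ‖H1.val u‖ ^ 2 := by
    rw [← real_inner_self_eq_norm_sq, L2.inner_def]
    simp [sq]
  have h2 : ∫ x in Omega, ‖H1.grad u x‖ ^ 2 = ‖H1.grad u‖ ^ 2 := by
    rw [← real_inner_self_eq_norm_sq, L2.inner_def]
    simp only [real_inner_self_eq_norm_sq]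
  rw [energy, h1, h2, stepForm_self, ContinuousLinearMap.comp_apply, surfaceMeanL_apply]
  ring

theorem solvesEulerLagrange_iff (u : H1) :
    SolvesEulerLagrange S T τ u ↔ ∀ θ, stepForm τ u θ = (surfaceMeanL S ∘L T) θ := by
  refine forall_congr' fun θ => ?_
  have h1 : ∫ x in Omega, H1.val u x * H1.val θ x = inner ℝ (H1.val u) (H1.val θ) := by
    rw [L2.inner_def]
    simp [mul_comm]
  have h2 : ∫ x in Omega, inner ℝ (H1.grad u x) (H1.grad θ x)
      = inner ℝ (H1.grad u) (H1.grad θ) := (L2.inner_def _ _).symm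
  rw [h1, h2, stepForm_apply, ContinuousLinearMap.comp_apply, surfaceMeanL_apply]
  constructor <;> intro h <;> linarith

/-- The energy has a unique minimizer, and it is a critical point. -/
theorem exists_unique_energy_minimizer (hτ : 0 < τ) :
    ∃ u : H1,
      (∀ v, energy S T τ u ≤ energy S T τ v) ∧
      (∀ w, (∀ v, energy S T τ w ≤ energy S T τ v) → w = u) ∧
      (∀ θ : H1, HasDerivAt (fun s : ℝ => energy S T τ (u + s • θ)) 0 0) ∧
      SolvesEulerLagrange S T τ u := by
  simp only [solvesEulerLagrange_iff, energy_eq]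
  exact (isCoercive_stepForm hτ).exists_unique_minimizer (stepForm_comm τ) _

end Energy

/-! ### Existence of the trace operator. -/

theorem H1.isWeakGradient (u : H1) : IsWeakGradient (H1.val u) (H1.grad u) := u.2

theorem H1.norm_val_le (u : H1) : ‖H1.val u‖ ≤ ‖u‖ :=
  (sq_le_sq₀ (norm_nonneg _) (norm_nonneg _)).1 (by rw [H1.norm_sq]; nlinarith [sq_nonneg ‖H1.grad u‖])

theorem H1.norm_grad_le (u : H1) : ‖H1.grad u‖ ≤ ‖u‖ :=
  (sq_le_sq₀ (norm_nonneg _) (norm_nonneg _)).1 (by rw [H1.norm_sq]; nlinarith [sq_nonneg ‖H1.val u‖])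

theorem H1.norm_le (u : H1) : ‖u‖ ≤ ‖H1.val u‖ + ‖H1.grad u‖ :=
  (sq_le_sq₀ (norm_nonneg _) (by positivity)).1 (by
    rw [H1.norm_sq]
    nlinarith [mul_nonneg (norm_nonneg (H1.val u)) (norm_nonneg (H1.grad u))])

/-- The element of `H¹(Ω)` given by a function and its weak gradient. -/
def H1.ofFunction {f : E3 → ℝ} {G : E3 → E3} (hf : MemLp f 2 volOmega) (hG : MemLp G 2 volOmega)
    (h : IsWeakGradient f G) : H1 :=
  ⟨WithLp.toLp 2 (hf.toLp f, hG.toLp G), h.congr hf.coeFn_toLp.symm hG.coeFn_toLp.symm⟩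

section Trace

variable {S : Set E3} [IsFiniteMeasure (surfaceMeasure S)]

theorem memLp_surfaceMeasure (hS : S ⊆ unitCube) (hSm : MeasurableSet S) {f : E3 → ℝ}
    (hf : Continuous f) : MemLp f 2 (surfaceMeasure S) :=
  memLp_restrict_of_continuous
    (isBounded_Omega.subset ((hS.trans unitCube_subset_midCube).trans midCube_subset_Omega)) hSm hf

theorem memLp_mollify_val (hS : S ⊆ unitCube) (hSm : MeasurableSet S) (n : ℕ) (u : H1) :
    MemLp (mollify n (H1.val u)) 2 (surfaceMeasure S) :=
  memLp_surfaceMeasure hS hSm (contDiff_mollify n (Lp.memLp (H1.val u))).continuous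

/-- The restriction to `S` of the mollification of a function in `H¹(Ω)`. -/
def mollifiedTrace (hS : S ⊆ unitCube) (hSm : MeasurableSet S) (n : ℕ) :
    H1 →ₗ[ℝ] Lp ℝ 2 (surfaceMeasure S) where
  toFun u := (memLp_mollify_val hS hSm n u).toLp (mollify n (H1.val u))
  map_add' u v := by
    rw [← MemLp.toLp_add]
    congr 1
    rw [← mollify_add n (Lp.memLp _) (Lp.memLp _)]
    exact mollify_congr n (Lp.coeFn_add (H1.val u) (H1.val v))
  map_smul' c u := by
    rw [RingHom.id_apply, ← MemLp.toLp_const_smul]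
    congr 1
    rw [← mollify_smul]
    exact mollify_congr n (Lp.coeFn_smul c (H1.val u))

theorem coeFn_mollifiedTrace (hS : S ⊆ unitCube) (hSm : MeasurableSet S) (n : ℕ) (u : H1) :
    mollifiedTrace hS hSm n u =ᵐ[surfaceMeasure S] mollify n (H1.val u) :=
  (memLp_mollify_val hS hSm n u).coeFn_toLp

/-- The trace inequality with constant `C` for `C¹` functions. -/
def TraceInequality (S : Set E3) (C : ℝ≥0) : Prop :=
  ∀ v : E3 → ℝ, ContDiff ℝ 1 v → eLpNorm v 2 (surfaceMeasure S)
    ≤ C * (eLpNorm v 2 (volume.restrict midCube) + eLpNorm (gradient v) 2 (volume.restrict midCube))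

/-- The error of the mollification in `H¹`. -/
def H1.mollifyError (n : ℕ) (u : H1) : ℝ≥0∞ :=
  HeatStep.mollifyError n (H1.val u) + HeatStep.mollifyError n (H1.grad u)

theorem H1.tendsto_mollifyError (u : H1) :
    Tendsto (fun n => H1.mollifyError n u) atTop (𝓝 0) := by
  have h := (HeatStep.tendsto_mollifyError (Lp.memLp (H1.val u))).add
    (HeatStep.tendsto_mollifyError (Lp.memLp (H1.grad u)))
  rwa [add_zero] at h

theorem gradient_mollify_val (n : ℕ) (u : H1) {x : E3} (hx : x ∈ midCube) :
    gradient (mollify n (H1.val u)) x = mollify n (H1.grad u) x :=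
  gradient_mollify n (Lp.memLp _) (Lp.memLp _) (H1.isWeakGradient u) hx

/-- The trace inequality is applied to the difference of two mollifications. It must stay on
`midCube`: near the boundary of `Omega` the gradient of a mollification also sees the jump of the
zero extension. -/
theorem edist_mollifiedTrace_le (hS : S ⊆ unitCube) (hSm : MeasurableSet S) {C : ℝ≥0}
    (hC : TraceInequality S C) (n m : ℕ) (u : H1) :
    edist (mollifiedTrace hS hSm n u) (mollifiedTrace hS hSm m u)
      ≤ C * (H1.mollifyError n u + H1.mollifyError m u) := by
  have hs : ∀ n, ContDiff ℝ 1 (mollify n (H1.val u)) := fun n =>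
    (contDiff_mollify n (Lp.memLp _)).of_le (by simp)
  refine (Lp.edist_toLp_toLp _ _ (memLp_mollify_val hS hSm n u)
    (memLp_mollify_val hS hSm m u)).trans_le ((hC _ ((hs n).sub (hs m))).trans
    (mul_le_mul_right ?_ _))
  have h1 : eLpNorm (mollify n (H1.val u) - mollify m (H1.val u)) 2 (volume.restrict midCube)
      ≤ HeatStep.mollifyError n (H1.val u) + HeatStep.mollifyError m (H1.val u) :=
    (eLpNorm_mono_measure _ Measure.restrict_le_self).trans
      (eLpNorm_mollify_sub_mollify_le n m (Lp.memLp _))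
  have h2 : eLpNorm (gradient (mollify n (H1.val u) - mollify m (H1.val u))) 2
      (volume.restrict midCube)
      ≤ HeatStep.mollifyError n (H1.grad u) + HeatStep.mollifyError m (H1.grad u) := by
    refine le_trans (le_of_eq (eLpNorm_congr_ae ?_)) ((eLpNorm_mono_measure _
      Measure.restrict_le_self).trans (eLpNorm_mollify_sub_mollify_le n m (Lp.memLp (H1.grad u))))
    filter_upwards [ae_restrict_mem isOpen_midCube.measurableSet] with x hx
    rw [gradient_sub ((hs n).differentiable one_ne_zero x) ((hs m).differentiable one_ne_zero x),
      gradient_mollify_val n u hx, gradient_mollify_val m u hx]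
    rfl
  refine (add_le_add h1 h2).trans_eq ?_
  rw [H1.mollifyError, H1.mollifyError, add_add_add_comm]

/-- As the error term tends to zero, this bound passes to the limit and shows that the trace is
bounded. -/
theorem enorm_mollifiedTrace_le (hS : S ⊆ unitCube) (hSm : MeasurableSet S) {C : ℝ≥0}
    (hC : TraceInequality S C) (n : ℕ) (u : H1) :
    ‖mollifiedTrace hS hSm n u‖ₑ
      ≤ C * (H1.mollifyError n u + (‖H1.val u‖ₑ + ‖H1.grad u‖ₑ)) := by
  have hs : ContDiff ℝ 1 (mollify n (H1.val u)) :=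
    (contDiff_mollify n (Lp.memLp _)).of_le (by simp)
  refine (Lp.enorm_toLp (memLp_mollify_val hS hSm n u)).trans_le ((hC _ hs).trans (mul_le_mul_right ?_ _))
  have h1 : eLpNorm (mollify n (H1.val u)) 2 (volume.restrict midCube)
      ≤ HeatStep.mollifyError n (H1.val u) + ‖H1.val u‖ₑ := by
    rw [Lp.enorm_def]
    exact (eLpNorm_mono_measure _ Measure.restrict_le_self).trans
      (eLpNorm_mollify_le n (Lp.memLp _))
  have h2 : eLpNorm (gradient (mollify n (H1.val u))) 2 (volume.restrict midCube)
      ≤ HeatStep.mollifyError n (H1.grad u) + ‖H1.grad u‖ₑ := by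
    rw [Lp.enorm_def]
    refine le_trans (le_of_eq (eLpNorm_congr_ae ?_)) ((eLpNorm_mono_measure _
      Measure.restrict_le_self).trans (eLpNorm_mollify_le n (Lp.memLp (H1.grad u))))
    filter_upwards [ae_restrict_mem isOpen_midCube.measurableSet] with x hx
    exact gradient_mollify_val n u hx
  refine (add_le_add h1 h2).trans_eq ?_
  rw [H1.mollifyError, add_add_add_comm]

/-- The traces of the mollifications converge to a bounded operator. -/
theorem exists_tendsto_mollifiedTrace (hS : S ⊆ unitCube) (hSm : MeasurableSet S) {C : ℝ≥0}
    (hC : TraceInequality S C) : ∃ T : H1 →L[ℝ] Lp ℝ 2 (surfaceMeasure S),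
      ∀ u, Tendsto (fun n => mollifiedTrace hS hSm n u) atTop (𝓝 (T u)) := by
  have hcau : ∀ u, ∃ t, Tendsto (fun n => mollifiedTrace hS hSm n u) atTop (𝓝 t) := by
    intro u
    refine cauchySeq_tendsto_of_complete (EMetric.cauchySeq_iff.2 fun ε hε => ?_)
    have hlim : Tendsto (fun p : ℕ × ℕ => C * (H1.mollifyError p.1 u + H1.mollifyError p.2 u))
        (atTop ×ˢ atTop) (𝓝 0) := by
      have h := ((H1.tendsto_mollifyError u).comp (tendsto_fst (g := atTop))).add
        ((H1.tendsto_mollifyError u).comp (tendsto_snd (f := atTop)))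
      simpa using ENNReal.Tendsto.const_mul (a := C) h (Or.inr ENNReal.coe_ne_top)
    rw [prod_atTop_atTop_eq] at hlim
    obtain ⟨⟨N, M⟩, hN⟩ := eventually_atTop.1 (hlim.eventually_lt_const hε)
    exact ⟨max N M, fun m hm n hn => (edist_mollifiedTrace_le hS hSm hC m n u).trans_lt
      (hN (m, n) ⟨(le_max_left _ _).trans hm, (le_max_right _ _).trans hn⟩)⟩
  choose t ht using hcau
  let L : H1 →ₗ[ℝ] Lp ℝ 2 (surfaceMeasure S) :=
    linearMapOfTendsto t (mollifiedTrace hS hSm) (tendsto_pi_nhds.2 ht)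
  -- The factor `2` arises because the norms of the function and of its gradient are each at most
  -- `‖u‖`.
  refine ⟨L.mkContinuous (2 * C) fun u => ?_, ht⟩
  have h1 : Tendsto (fun n => ‖mollifiedTrace hS hSm n u‖ₑ) atTop (𝓝 ‖t u‖ₑ) := (ht u).enorm
  have h2 : Tendsto (fun n => C * (H1.mollifyError n u + (‖H1.val u‖ₑ + ‖H1.grad u‖ₑ))) atTop
      (𝓝 (C * (0 + (‖H1.val u‖ₑ + ‖H1.grad u‖ₑ)))) :=
    ENNReal.Tendsto.const_mul ((H1.tendsto_mollifyError u).add_const _)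
      (Or.inr ENNReal.coe_ne_top)
  have h3 := le_of_tendsto_of_tendsto' h1 h2 fun n => enorm_mollifiedTrace_le hS hSm hC n u
  rw [zero_add] at h3
  have h4 : ‖t u‖ ≤ C * (‖H1.val u‖ + ‖H1.grad u‖) := by
    have h5 : ‖t u‖₊ ≤ C * (‖H1.val u‖₊ + ‖H1.grad u‖₊) := by
      simp only [enorm_eq_nnnorm] at h3
      exact_mod_cast h3
    exact_mod_cast h5
  refine h4.trans ?_
  have := mul_le_mul_of_nonneg_left (add_le_add (H1.norm_val_le u) (H1.norm_grad_le u)) C.coe_nonneg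
  linarith

/-- Convergence in `L²(S)` gives convergence almost everywhere on `S` along a subsequence. At each
point of `S` the mollifications also converge to `f`, which is continuous there, so the two limits
agree. -/
theorem isTraceOperator_of_tendsto (hS : S ⊆ unitCube) (hSm : MeasurableSet S)
    {T : H1 →L[ℝ] Lp ℝ 2 (surfaceMeasure S)}
    (hT : ∀ u, Tendsto (fun n => mollifiedTrace hS hSm n u) atTop (𝓝 (T u))) :
    IsTraceOperator S T := by
  intro u f V hV hSV hf huf
  obtain ⟨ns, hns, h⟩ := (tendstoInMeasure_of_tendsto_Lp (hT u)).exists_seq_tendsto_ae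
  have hcoe : ∀ᵐ x ∂(surfaceMeasure S), ∀ n,
      mollifiedTrace hS hSm n u x = mollify n (H1.val u) x :=
    ae_all_iff.2 fun n => coeFn_mollifiedTrace hS hSm n u
  filter_upwards [h, hcoe, ae_restrict_mem hSm] with x h1 h2 h3
  simp only [h2, mollify_congr _ huf] at h1
  have h4 := tendsto_mollify ((Lp.aestronglyMeasurable (H1.val u)).congr huf)
    (midCube_subset_Omega (unitCube_subset_midCube (hS h3)))
    (hf.continuousAt (hV.mem_nhds (hSV h3)))
  exact tendsto_nhds_unique h1 (h4.comp hns.tendsto_atTop)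

end Trace

/-! ### Uniqueness of the trace operator by density. -/

section Uniqueness

/-- A smooth cutoff function between `[-1, 1]³` and the middle cube. -/
theorem exists_cutoff : ∃ (χ : E3 → ℝ) (V : Set E3), ContDiff ℝ ∞ χ ∧ IsOpen V ∧ unitCube ⊆ V ∧
    (∀ x ∈ V, χ x = 1) ∧ (∀ x ∉ midCube, χ x = 0) ∧ (∀ x, ‖χ x‖ ≤ 1) ∧
    ∃ M : ℝ≥0, ∀ x, ‖gradient χ x‖ ≤ M := by
  obtain ⟨χ, h1, h0, hI⟩ := exists_contMDiffMap_one_nhds_of_subset_interior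
    (modelWithCornersSelf ℝ E3) (n := ⊤) (s := unitCube) (t := midCube) isClosed_unitCube
    (by rw [isOpen_midCube.interior_eq]; exact unitCube_subset_midCube)
  obtain ⟨V, hV, hSV, hV1⟩ := eventually_nhdsSet_iff_exists.1 h1
  have hχ : ContDiff ℝ ∞ χ := χ.contMDiff.contDiff
  have hc : HasCompactSupport χ := by
    refine HasCompactSupport.of_support_subset_isCompact
      (isBounded_Omega.isCompact_closure) fun x hx => ?_
    refine subset_closure (midCube_subset_Omega ?_)
    by_contra hn
    exact hx (h0 x hn)
  obtain ⟨M, hM⟩ := (hc.fderiv ℝ).exists_bound_of_continuous (hχ.continuous_fderiv (by simp))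
  refine ⟨χ, V, hχ, hV, hSV, hV1, h0, fun x => ?_, M.toNNReal, fun x => ?_⟩
  · rw [Real.norm_eq_abs, abs_of_nonneg (hI x).1]
    exact (hI x).2
  · rw [gradient, LinearIsometryEquiv.norm_map]
    exact (hM x).trans (Real.le_coe_toNNReal M)

theorem eLpNorm_sub_le_mollifyError {F : Type*} [NormedAddCommGroup F] [NormedSpace ℝ F]
    (n : ℕ) (f : E3 → F) :
    eLpNorm (mollify n f - f) 2 volOmega ≤ mollifyError n f := by
  refine le_trans (le_of_eq (eLpNorm_congr_ae ?_)) (eLpNorm_mono_measure _ Measure.restrict_le_self)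
  filter_upwards [indicator_ae_eq_restrict (f := f) (μ := volume) isOpen_Omega.measurableSet]
    with x hx
  rw [Pi.sub_apply, Pi.sub_apply, hx]

/-- Functions in `H¹(Ω)` that are continuous near `[-1, 1]³` are dense. -/
theorem exists_tendsto_continuousOn (u : H1) :
    ∃ (V : Set E3) (w : ℕ → H1) (f : ℕ → E3 → ℝ), IsOpen V ∧ unitCube ⊆ V ∧
      (∀ n, ContinuousOn (f n) V) ∧ (∀ n, H1.val (w n) =ᵐ[volOmega] f n) ∧
      Tendsto w atTop (𝓝 u) := by
  obtain ⟨χ, V, hχ, hV, hSV, h1, h0, hle, M, hM⟩ := exists_cutoff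
  have hu := Lp.memLp (H1.val u)
  have hG := Lp.memLp (H1.grad u)
  have hs : ∀ n, ContDiff ℝ 1 (mollify n (H1.val u)) := fun n =>
    (contDiff_mollify n hu).of_le (by simp)
  have hv : ∀ n, MemLp (mollify n (H1.val u)) 2 volOmega := fun n =>
    memLp_restrict_of_continuous isBounded_Omega isOpen_Omega.measurableSet (hs n).continuous
  have hgv : ∀ n, MemLp (gradient (mollify n (H1.val u))) 2 volOmega := fun n =>
    memLp_restrict_of_continuous isBounded_Omega isOpen_Omega.measurableSet
      (continuous_gradient (hs n))
  -- The approximants are `u + χ (uₙ - u)` with `uₙ` the mollification. Near `unitCube`, where `χ =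
  -- 1`, this is the smooth `uₙ`; outside `midCube` it is `u` itself, so nothing has to be
  -- approximated near the boundary of `Omega`.
  let d : ℕ → E3 → ℝ := fun n => mollify n (H1.val u) - H1.val u
  let g : ℕ → E3 → E3 := fun n => gradient (mollify n (H1.val u)) - H1.grad u
  have hd : ∀ n, MemLp (d n) 2 volOmega := fun n => (hv n).sub hu
  have hg : ∀ n, MemLp (g n) 2 volOmega := fun n => (hgv n).sub hG
  have hw : ∀ n, IsWeakGradient (fun x => χ x * d n x)
      (fun x => χ x • g n x + d n x • gradient χ x) := fun n =>
    ((isWeakGradient_gradient (hs n)).sub (H1.isWeakGradient u) (hv n) (hgv n) hu hG).smooth_mul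
      (hd n) (hg n) hχ
  have hχm : AEStronglyMeasurable χ volOmega := hχ.continuous.aestronglyMeasurable
  have hχg : AEStronglyMeasurable (gradient χ) volOmega :=
    (continuous_gradient (hχ.of_le (by simp))).aestronglyMeasurable
  have m1 : ∀ n, eLpNorm (fun x => χ x * d n x) 2 volOmega ≤ mollifyError n (H1.val u) := by
    intro n
    refine (eLpNorm_mono fun x => ?_).trans (eLpNorm_sub_le_mollifyError n (H1.val u))
    rw [norm_mul]
    exact mul_le_of_le_one_left (norm_nonneg _) (hle x)
  have m2 : ∀ n, eLpNorm (fun x => χ x • g n x) 2 volOmega ≤ mollifyError n (H1.grad u) := by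
    intro n
    refine (eLpNorm_mono fun x => ?_).trans (eLpNorm_sub_le_mollifyError n (H1.grad u))
    -- The gradient of the mollification is only known on `midCube`; elsewhere `χ` vanishes.
    by_cases hx : x ∈ midCube
    · rw [norm_smul]
      have : g n x = (mollify n (H1.grad u) - H1.grad u) x := by
        rw [Pi.sub_apply, ← gradient_mollify_val n u hx]
        rfl
      rw [this]
      exact mul_le_of_le_one_left (norm_nonneg _) (hle x)
    · rw [h0 x hx, zero_smul, norm_zero]
      exact norm_nonneg _
  have m3 : ∀ n, eLpNorm (fun x => d n x • gradient χ x) 2 volOmega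
      ≤ M * mollifyError n (H1.val u) := by
    intro n
    have := eLpNorm_le_nnreal_smul_eLpNorm_of_ae_le_mul (μ := volOmega) (c := M) (g := d n)
      (f := fun x => d n x • gradient χ x) (Eventually.of_forall fun x => by
        rw [← NNReal.coe_le_coe, NNReal.coe_mul, coe_nnnorm, coe_nnnorm, norm_smul, mul_comm]
        exact mul_le_mul_of_nonneg_right (hM x) (norm_nonneg _)) 2
    rw [ENNReal.smul_def, smul_eq_mul] at this
    exact this.trans (mul_le_mul_right (eLpNorm_sub_le_mollifyError n (H1.val u)) _)
  have a2 : ∀ n, AEStronglyMeasurable (fun x => χ x • g n x) volOmega := fun n => hχm.smul (hg n).1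
  have a3 : ∀ n, AEStronglyMeasurable (fun x => d n x • gradient χ x) volOmega := fun n =>
    (hd n).1.smul hχg
  have m4 : ∀ n, eLpNorm (fun x => χ x • g n x + d n x • gradient χ x) 2 volOmega
      ≤ mollifyError n (H1.grad u) + M * mollifyError n (H1.val u) := fun n =>
    (eLpNorm_add_le (a2 n) (a3 n) (by norm_num)).trans (add_le_add (m2 n) (m3 n))
  have l1 : ∀ n, MemLp (fun x => χ x * d n x) 2 volOmega := fun n =>
    (hd n).of_le (hχm.mul (hd n).1) (Eventually.of_forall fun x => by
      rw [norm_mul]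
      exact mul_le_of_le_one_left (norm_nonneg _) (hle x))
  have l2 : ∀ n, MemLp (fun x => χ x • g n x) 2 volOmega := fun n =>
    (hg n).of_le (a2 n) (Eventually.of_forall fun x => by
      rw [norm_smul]
      exact mul_le_of_le_one_left (norm_nonneg _) (hle x))
  have l3 : ∀ n, MemLp (fun x => d n x • gradient χ x) 2 volOmega := fun n =>
    (hd n).of_le_mul (c := M) (a3 n) (Eventually.of_forall fun x => by
      rw [norm_smul, mul_comm]
      exact mul_le_mul_of_nonneg_right (hM x) (norm_nonneg _))
  let z : ℕ → H1 := fun n => H1.ofFunction (l1 n) ((l2 n).add (l3 n)) (hw n)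
  have hz : Tendsto z atTop (𝓝 0) := by
    have e1 := tendsto_mollifyError hu
    have e2 := tendsto_mollifyError hG
    have e3 : Tendsto (fun n => mollifyError n (H1.grad u) + M * mollifyError n (H1.val u)) atTop
        (𝓝 0) := by
      simpa using e2.add (ENNReal.Tendsto.const_mul (a := M) e1 (Or.inr ENNReal.coe_ne_top))
    have t1 := tendsto_of_tendsto_of_tendsto_of_le_of_le tendsto_const_nhds e1
      (fun _ => zero_le) m1
    have t2 := tendsto_of_tendsto_of_tendsto_of_le_of_le tendsto_const_nhds e3
      (fun _ => zero_le) m4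
    have n1 : Tendsto (fun n => ‖H1.val (z n)‖) atTop (𝓝 0) :=
      ((ENNReal.tendsto_toReal ENNReal.zero_ne_top).comp t1).congr fun n =>
        (Lp.norm_toLp _ (l1 n)).symm
    have n2 : Tendsto (fun n => ‖H1.grad (z n)‖) atTop (𝓝 0) :=
      ((ENNReal.tendsto_toReal ENNReal.zero_ne_top).comp t2).congr fun n =>
        (Lp.norm_toLp _ ((l2 n).add (l3 n))).symm
    refine squeeze_zero_norm (fun n => H1.norm_le (z n)) ?_
    simpa using n1.add n2
  refine ⟨V, fun n => u + z n, fun n x => H1.val u x + χ x * d n x, hV, hSV, fun n => ?_,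
    fun n => ?_, by simpa using hz.const_add u⟩
  · refine (hs n).continuous.continuousOn.congr fun x hx => ?_
    simp only [h1 x hx, one_mul, d, Pi.sub_apply, add_sub_cancel]
  · refine (Lp.coeFn_add (H1.val u) (H1.val (z n))).trans ?_
    filter_upwards [(l1 n).coeFn_toLp] with x hx
    rw [Pi.add_apply, ← hx]
    rfl

/-- Two trace operators agree on functions continuous near `unitCube`, hence by density and
continuity everywhere. -/
theorem IsTraceOperator.unique {S : Set E3} (hS : S ⊆ unitCube)
    {T T' : H1 →L[ℝ] Lp ℝ 2 (surfaceMeasure S)} (hT : IsTraceOperator S T)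
    (hT' : IsTraceOperator S T') : T' = T := by
  ext1 u
  obtain ⟨V, w, f, hV, hSV, hf, hwf, hw⟩ := exists_tendsto_continuousOn u
  have heq : ∀ n, T' (w n) = T (w n) := fun n => Lp.ext
    ((hT' (w n) (f n) V hV (hS.trans hSV) (hf n) (hwf n)).trans
      (hT (w n) (f n) V hV (hS.trans hSV) (hf n) (hwf n)).symm)
  refine tendsto_nhds_unique ((T'.continuous.tendsto u).comp hw) ?_
  exact ((T.continuous.tendsto u).comp hw).congr fun n => (heq n).symm

end Uniqueness

/-! ### Assembly of the theorem. -/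

/-- Space is connected, so a nonempty set without boundary would be all of it, but a point with a
coordinate `2` lies outside the cube. -/
theorem frontier_nonempty_of_subset_unitCube {D : Set E3} (hne : D.Nonempty)
    (hsub : D ⊆ unitCube) : (frontier D).Nonempty := by
  refine nonempty_frontier_iff.2 ⟨hne, fun h => ?_⟩
  have h1 : EuclideanSpace.single (0 : Fin 3) (2 : ℝ) ∈ unitCube := hsub (h ▸ Set.mem_univ _)
  have h2 := (h1 0).2
  norm_num at h2

end HeatStep

end

theorem proposition1 (D : Set HeatStep.E3) (hne : D.Nonempty)
    (hD : HeatStep.IsLipschitzSet D) (hsub : D ⊆ HeatStep.unitCube) :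
    -- the mean over the surface is meaningful
    (0 < HeatStep.surfaceMeasure (frontier D) Set.univ ∧
      HeatStep.surfaceMeasure (frontier D) Set.univ < ⊤) ∧
    -- there is exactly one trace operator, and with it:
    ∃ T : HeatStep.H1 →L[ℝ] Lp ℝ 2 (HeatStep.surfaceMeasure (frontier D)),
      HeatStep.IsTraceOperator (frontier D) T ∧
      (∀ T', HeatStep.IsTraceOperator (frontier D) T' → T' = T) ∧
      ∀ τ : ℝ, 0 < τ →
        ∃ u : HeatStep.H1,
          -- `u` is a minimizer
          (∀ v, HeatStep.energy (frontier D) T τ u ≤ HeatStep.energy (frontier D) T τ v) ∧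
          -- it is the only one
          (∀ w, (∀ v, HeatStep.energy (frontier D) T τ w ≤ HeatStep.energy (frontier D) T τ v) →
            w = u) ∧
          -- the first variation of the energy vanishes at `u`
          (∀ θ : HeatStep.H1, HasDerivAt
            (fun s : ℝ => HeatStep.energy (frontier D) T τ (u + s • θ)) 0 0) ∧
          -- `u` solves the weak form of the backward Euler step
          HeatStep.SolvesEulerLagrange (frontier D) T τ u := by
  have hS : frontier D ⊆ HeatStep.unitCube :=
    frontier_subset_closure.trans (closure_minimal hsub HeatStep.isClosed_unitCube)
  have hSm : MeasurableSet (frontier D) := isClosed_frontier.measurableSet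
  have hcomp : IsCompact (frontier D) := Metric.isCompact_of_isClosed_isBounded isClosed_frontier
    (HeatStep.isBounded_Omega.subset ((hS.trans HeatStep.unitCube_subset_midCube).trans
      HeatStep.midCube_subset_Omega))
  have hfin := hD.surfaceMeasure_lt_top hcomp
  have : IsFiniteMeasure (HeatStep.surfaceMeasure (frontier D)) := ⟨hfin⟩
  obtain ⟨C, hC⟩ := hD.exists_eLpNorm_frontier_le hcomp HeatStep.isOpen_midCube.measurableSet
    (δ := 1 / 20) (by norm_num) fun x hx => HeatStep.closedBall_subset_midCube (hS hx)
  obtain ⟨T, hT⟩ := HeatStep.exists_tendsto_mollifiedTrace hS hSm hC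
  have hTr := HeatStep.isTraceOperator_of_tendsto hS hSm hT
  exact ⟨⟨hD.surfaceMeasure_pos (HeatStep.frontier_nonempty_of_subset_unitCube hne hsub), hfin⟩,
    T, hTr, fun T' hT' => HeatStep.IsTraceOperator.unique hS hTr hT',
    fun τ hτ => HeatStep.exists_unique_energy_minimizer T τ hτ⟩
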